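/- Let $H$ be a Hamiltonian on $n$ qubits which are grouped into parties, $$H=A+\sum_{l=1}^{L}H_l^{(2)},\qquad A=\sum_k H_k^{(1)},$$ where all terms $H_k^{(1)},H_l^{(2)}$ are Hermitian, act on at most two qubits and have spectral norm at most $1$; each $H_k^{(1)}$ acts within a single party and each $H_l^{(2)}$ acts on two qubits of different parties. Suppose that each qubit interacts (through a common term) with at most $d'$ other qubits and that at most $m(d'+1)$ terms act on each qubit (with $m=1$ if no two terms act on the same set of qubits, or if at most $d'$ terms act on each qubit). Let $h_B=\sum_l\lVert H_l^{(2)}\rVert$, where $\lVert\cdot\rVert$ is the spectral norm. Write $X_1=-iH_1^{(2)},\dots,X_L=-iH_L^{(2)},X_{L+1}=-iA$. Let $p\ge 1$ and let $$\mathscr S(t)=\prod_{\upsilon=1}^{\Upsilon}\prod_{\gamma=1}^{L+1}e^{t\,a_{(\upsilon,\gamma)}X_{\pi_\upsilon(\gamma)}}$$ (indices increase from right to left) be a $p$th-order product formula with $\Upsilon$ stages, permutations $\pi_\upsilon$ and real coefficients $|a_{(\upsilon,\gamma)}|\le 1$; that is, $\mathscr S(t)=e^{-itH}+O(t^{p+1})$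 as $t\to 0$. The case $\pi_\upsilon=\mathrm{id}$ is $$\mathscr S(t)=e^{-ita_\Upsilon A}\prod_l e^{-ita_{(\Upsilon,l)}H_l^{(2)}}\cdots e^{-ita_1A}\prod_l e^{-ita_{(1,l)}H_l^{(2)}}.$$ 1. There is a constant $C=C(p,\Upsilon,m)$ such that, for all $n$, $L$, $d'$, all such $H$ and $\mathscr S$, and all $t\ge 0$, $$\lVert\mathscr S(t)-e^{-itH}\rVert\le C\,d'^{\,p(p+1)/2}\,h_B\,t^{p+1}.$$ 2. With $C=C(p,\Upsilon,m)$, for all $t\ge 0$ and $\epsilon>0$ there is an integer $r\ge 1$ with $$r\le\max\Bigl\{1,\;C\,d'^{\,(1+p)/2}\,\frac{h_B^{1/p}\,t^{1+1/p}}{\epsilon^{1/p}}\Bigr\}$$ such that $\lVert\mathscr S(t/s)^s-e^{-itH}\rVert\le\epsilon$ for every integer $s\ge r$. In particular, for constant $d'$ (and $m,p,\Upsilon$), it suffices to choose a Trotter number $r=O\bigl(h_B^{1/p}t^{1+1/p}/\epsilon^{1/p}\bigr)$. 3. Choosing $p$ sufficiently large, $r=O\bigl(h_B^{o(1)}t^{1+o(1)}/\epsilon^{o(1)}\bigr)$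 suffices: for every $\delta>0$ there is $p_0$ such that for every $p\ge p_0$, (i) for some $\Upsilon$ there are, for every $L$, $\Upsilon$-stage product formulas (chosen independently of $n$ and $H$) which are of $p$th order for every clustered Hamiltonian as above with $L$ terms $H_l^{(2)}$; and (ii) for all $\Upsilon,m,d'$ there is a constant $C$ such that, for all $n$, $L$, $H$, $\mathscr S$ as above and all $t\ge 0$, $\epsilon>0$, there is an integer $r\ge 1$ with $r\le\max\{1,\,C\,h_B^{\delta}\,t^{1+\delta}/\epsilon^{\delta}\}$ such that $\lVert\mathscr S(t/s)^s-e^{-itH}\rVert\le\epsilon$ for every integer $s\ge r$. -/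

import Mathlib

open scoped Matrix.Norms.L2Operator

noncomputable section

/-- A product formula with `Υ` stages for `Γ` summands: real coefficients `a_(υ,γ)`, bounded by one
in absolute value, and for every stage a permutation which gives the order of the summands. -/
structure ProductFormula (Υ Γ : ℕ) where
  coeff : Fin Υ → Fin Γ → ℝ
  perm : Fin Υ → Equiv.Perm (Fin Γ)
  coeff_le : ∀ υ γ, |coeff υ γ| ≤ 1

namespace ProductFormula

variable {Υ Γ : ℕ} {N : Type} [Fintype N] [DecidableEq N]

/-- One stage, `∏_γ exp (t a_(υ,γ) X_(π_υ γ))`, with indices increasing from right to left. -/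
def stage (F : ProductFormula Υ Γ) (X : Fin Γ → Matrix N N ℂ) (t : ℝ) (υ : Fin Υ) : Matrix N N ℂ :=
  (List.ofFn fun γ : Fin Γ =>
    NormedSpace.exp (((t * F.coeff υ γ : ℝ) : ℂ) • X (F.perm υ γ))).reverse.prod

/-- The product formula `𝒮(t) = ∏_υ ∏_γ exp (t a_(υ,γ) X_(π_υ γ))`, with indices increasing from
right to left. -/
def eval (F : ProductFormula Υ Γ) (X : Fin Γ → Matrix N N ℂ) (t : ℝ) : Matrix N N ℂ :=
  (List.ofFn fun υ : Fin Υ => F.stage X t υ).reverse.prod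

/-- For the summands `X`, the formula has order `p`: `𝒮(t) = exp (t ∑_γ X_γ) + O(t^(p+1))`
as `t → 0`. -/
def HasOrder (F : ProductFormula Υ Γ) (X : Fin Γ → Matrix N N ℂ) (p : ℕ) : Prop :=
  (fun t : ℝ => F.eval X t - NormedSpace.exp ((t : ℂ) • ∑ γ, X γ))
    =O[nhds 0] fun t : ℝ => t ^ (p + 1)

end ProductFormula

/-- Operators on `n` qubits, as matrices in the computational basis. -/
abbrev QubitOperator (n : ℕ) : Type := Matrix (Fin n → Fin 2) (Fin n → Fin 2) ℂ

/-- `T` acts only on the qubits in `S`: it is `M ⊗ 1`, with `M` an operator on the qubits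
in `S` and `1` the identity on the other qubits. -/
def QubitOperator.ActsOnlyOn {n : ℕ} (T : QubitOperator n) (S : Finset (Fin n)) : Prop :=
  ∃ M : Matrix (S → Fin 2) (S → Fin 2) ℂ, ∀ x y : Fin n → Fin 2,
    T x y = if ∀ q, q ∉ S → x q = y q then M (fun q => x q) (fun q => y q) else 0

/-- A clustered Hamiltonian `H = A + ∑_l H_l^(2)`, `A = ∑_k H_k^(1)`, on `n` qubits that are grouped
into parties. All terms are Hermitian, act on at most two qubits and have spectral norm at most
one. The terms of `A` act within a single party, the `L` terms `H_l^(2)` act between two different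
parties. -/
structure ClusteredHamiltonian (n L : ℕ) where
  /-- the party of a qubit -/
  party : Fin n → ℕ
  /-- the number of terms of `A` -/
  K : ℕ
  /-- the terms `H_k^(1)` -/
  intra : Fin K → QubitOperator n
  /-- the qubits on which `H_k^(1)` acts -/
  intraSupp : Fin K → Finset (Fin n)
  /-- the terms `H_l^(2)` -/
  inter : Fin L → QubitOperator n
  /-- the qubits on which `H_l^(2)` acts -/
  interSupp : Fin L → Finset (Fin n)
  intra_hermitian : ∀ k, (intra k).IsHermitian
  inter_hermitian : ∀ l, (inter l).IsHermitian
  intra_norm_le : ∀ k, ‖intra k‖ ≤ 1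
  inter_norm_le : ∀ l, ‖inter l‖ ≤ 1
  intra_acts : ∀ k, (intra k).ActsOnlyOn (intraSupp k)
  inter_acts : ∀ l, (inter l).ActsOnlyOn (interSupp l)
  intra_card_le : ∀ k, (intraSupp k).card ≤ 2
  intra_party : ∀ k, ∀ u ∈ intraSupp k, ∀ v ∈ intraSupp k, party u = party v
  inter_party : ∀ l, ∃ u v, interSupp l = {u, v} ∧ party u ≠ party v

namespace ClusteredHamiltonian

variable {n L : ℕ}

/-- `A`, the sum of all terms that act within a single party. -/
def A (H : ClusteredHamiltonian n L) : QubitOperator n := ∑ k, H.intra k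

/-- The Hamiltonian `A + ∑_l H_l^(2)`. -/
def total (H : ClusteredHamiltonian n L) : QubitOperator n := H.A + ∑ l, H.inter l

/-- The interaction strength `h_B = ∑_l ‖H_l^(2)‖`. -/
def strength (H : ClusteredHamiltonian n L) : ℝ := ∑ l, ‖H.inter l‖

/-- The qubits other than `u` with which `u` interacts, that is, on which some term acts that also
acts on `u`. -/
def neighbors (H : ClusteredHamiltonian n L) (u : Fin n) : Finset (Fin n) :=
  {v | v ≠ u ∧ ((∃ k, u ∈ H.intraSupp k ∧ v ∈ H.intraSupp k) ∨
    ∃ l, u ∈ H.interSupp l ∧ v ∈ H.interSupp l)}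

/-- The number of terms that act on the qubit `u`. -/
def numTerms (H : ClusteredHamiltonian n L) (u : Fin n) : ℕ :=
  (Finset.univ.filter fun k => u ∈ H.intraSupp k).card +
    (Finset.univ.filter fun l => u ∈ H.interSupp l).card

/-- Every qubit interacts with at most `d` other qubits, and the number of terms on a qubit is
bounded accordingly, with a multiplicity `m`. If no two terms act on the same set of qubits, or if
at most `d` terms act on each qubit, then the second condition follows with `m = 1`; if at most `m`
terms act on each set of qubits, it follows from the first. -/
def DegreeLE (H : ClusteredHamiltonian n L) (d m : ℕ) : Prop :=
  ∀ u, (H.neighbors u).card ≤ d ∧ H.numTerms u ≤ m * (d + 1)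

/-- The summands `-i H_1^(2), …, -i H_L^(2), -i A` to which product formulas are applied. When all
permutations are the identity, a stage is `exp (-i t a_υ A) ∏_l exp (-i t a_(υ,l) H_l^(2))`. -/
def summands (H : ClusteredHamiltonian n L) : Fin (L + 1) → QubitOperator n :=
  Fin.lastCases ((-Complex.I) • H.A) fun l => (-Complex.I) • H.inter l

/-- The exact evolution `exp (-i t H)`. -/
def evolution (H : ClusteredHamiltonian n L) (t : ℝ) : QubitOperator n :=
  NormedSpace.exp ((-Complex.I * t) • H.total)

/-- The error `‖𝒮(t/r)^r - exp (-i t H)‖` of `r` steps of the product formula; the Trotter error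
of the formula itself is the case `r = 1`. -/
def trotterError (H : ClusteredHamiltonian n L) {Υ : ℕ} (F : ProductFormula Υ (L + 1))
    (t : ℝ) (r : ℕ) : ℝ :=
  ‖F.eval H.summands (t / r) ^ r - H.evolution t‖

/-- `r` is a Trotter number from which on the accuracy `ε` is reached. -/
def TrotterNumberSuffices (H : ClusteredHamiltonian n L) {Υ : ℕ} (F : ProductFormula Υ (L + 1))
    (t ε : ℝ) (r : ℕ) : Prop :=
  1 ≤ r ∧ ∀ s, r ≤ s → H.trotterError F t s ≤ ε

end ClusteredHamiltonian

end

/-! List the exponents of `𝒮` as `y₁, y₂, …` and put `x = -iH`. Then `𝒮' = 𝒮 G`, where `G` is a sum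
of conjugated exponents. An order-`p` formula has `G(t) = x + O(t^p)`, so the Taylor coefficients of
`G` below degree `p` are those of the constant `x` (`generatorCoeff_eq_of_isBigO`). The Taylor
remainder of `G` is at most `t^p` times the sum of the norms of all `p`-fold nested commutators of
the exponents (`norm_generator_sub_sum_le`). All exponentials are unitary, so integration gives an
error `commBound · t^(p+1)` (`norm_expProd_sub_exp_le_commBound`).

The nested commutators are linear in `h_B` (`commBound_le_strength`). Around an innermost `H_l`, a
commutator with a local term vanishes or adds at most one qubit to the support, so degree and
multiplicity bound the number of surviving terms. If `A` is innermost, `[A, A] = 0` forces the next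
operator to be some `H_l`, and `[H_l, A] = -[A, H_l]` leads back to the first case. The result is of
size `(d+1)^p h_B`. For `d ≥ 1` this is within the claimed power of `d`, and for `d = 0` there are
no nonzero inter-party terms.

Errors of unitary steps add, so `s` steps cost `M t^(p+1) / s^p`, which determines the Trotter
number. To replace the exponent `1/p` by a larger `δ`, the quantity `h_B t / ε` must not be small.
When it is small, one step suffices by a second bound `2 Υ h_B t`, obtained by comparing `𝒮` with
exponentials of multiples of `A` alone (`norm_eval_sub_evolution_le_strength`). Formulas of every
order come from symmetrization and Suzuki's composition in alternation (`exists_productFormula`). -/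

noncomputable section

namespace TrotterError

open NormedSpace Filter Topology

/-! ### Products of exponentials and their generators -/

section BanachAlgebra

variable {𝔸 : Type*} [NormedRing 𝔸] [NormedAlgebra ℝ 𝔸]

section Exponential

variable [CompleteSpace 𝔸]

theorem exp_mul_exp_neg (x : 𝔸) : exp x * exp (-x) = 1 := by
  let _ : NormedAlgebra ℚ 𝔸 := .restrictScalars ℚ ℝ 𝔸
  rw [← exp_add_of_commute (Commute.neg_right (Commute.refl x)), add_neg_cancel, exp_zero]

theorem exp_neg_mul_exp (x : 𝔸) : exp (-x) * exp x = 1 := by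
  simpa using exp_mul_exp_neg (-x)

theorem exp_add_smul (a b : ℝ) (x : 𝔸) :
    exp ((a + b) • x) = exp (a • x) * exp (b • x) := by
  let _ : NormedAlgebra ℚ 𝔸 := .restrictScalars ℚ ℝ 𝔸
  rw [add_smul, exp_add_of_commute (((Commute.refl x).smul_left a).smul_right b)]

theorem analyticAt_exp_smul (x : 𝔸) (t : ℝ) : AnalyticAt ℝ (fun s : ℝ => exp (s • x)) t :=
  (exp_analytic (𝕂 := ℝ) (t • x)).comp_of_eq
    ((analyticAt_id (𝕜 := ℝ)).smul analyticAt_const) rfl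

theorem hasDerivAt_exp_neg_smul (x : 𝔸) (t : ℝ) :
    HasDerivAt (fun s : ℝ => exp (-(s • x))) (-(x * exp (-(t • x)))) t := by
  simpa using hasDerivAt_exp_smul_const' (𝕂 := ℝ) (-x) t

end Exponential

/-- The commutator with `y`, as a linear map. -/
def comm (y : 𝔸) : 𝔸 →ₗ[ℝ] 𝔸 := LinearMap.mulLeft ℝ y - LinearMap.mulRight ℝ y

@[simp] theorem comm_apply (y c : 𝔸) : comm y c = y * c - c * y := rfl

/-- All exponentials of real multiples of `x` are contractions. -/
def IsContractive (x : 𝔸) : Prop := ∀ t : ℝ, ‖exp (t • x)‖ ≤ 1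

theorem IsContractive.smul {x : 𝔸} (h : IsContractive x) (a : ℝ) : IsContractive (a • x) :=
  fun t => by simpa [smul_smul] using h (t * a)

theorem IsContractive.norm_exp_neg_le {x : 𝔸} (h : IsContractive x) (t : ℝ) :
    ‖exp (-(t • x))‖ ≤ 1 := by
  simpa using h (-t)

theorem IsContractive.norm_conj_le {x : 𝔸} (h : IsContractive x) (t : ℝ) (c : 𝔸) :
    ‖exp (-(t • x)) * c * exp (t • x)‖ ≤ ‖c‖ := by
  calc _ ≤ ‖exp (-(t • x))‖ * ‖c‖ * ‖exp (t • x)‖ := norm_mul₃_le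
    _ ≤ 1 * ‖c‖ * 1 := by
      gcongr
      · exact h.norm_exp_neg_le t
      · exact h t
    _ = ‖c‖ := by ring

/-- `∏ exp (t y)` over a list, with the head of the list as the rightmost factor. -/
def expProd : List 𝔸 → ℝ → 𝔸
  | [], _ => 1
  | y :: l, t => expProd l t * exp (t • y)

/-- The logarithmic derivative of `expProd`. -/
def generator : List 𝔸 → ℝ → 𝔸
  | [], _ => 0
  | y :: l, t => y + exp (-(t • y)) * generator l t * exp (t • y)

/-- The Taylor coefficients of `generator`. -/
def generatorCoeff : List 𝔸 → ℕ → 𝔸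
  | [], _ => 0
  | y :: l, k => (if k = 0 then y else 0) +
      ∑ j ∈ Finset.range (k + 1),
        ((k - j).factorial⁻¹ : ℝ) • ((-comm y) ^ (k - j)) (generatorCoeff l j)

@[simp] theorem expProd_zero_right [CompleteSpace 𝔸] (l : List 𝔸) : expProd l 0 = 1 := by
  induction l with
  | nil => rfl
  | cons y l ih => simp [expProd, ih]

theorem expProd_append (l l' : List 𝔸) (t : ℝ) :
    expProd (l ++ l') t = expProd l' t * expProd l t := by
  induction l with
  | nil => simp [expProd]
  | cons y l ih => simp [expProd, ih, mul_assoc]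

theorem norm_expProd_le [NormOneClass 𝔸] {l : List 𝔸} (hl : ∀ y ∈ l, IsContractive y) (t : ℝ) :
    ‖expProd l t‖ ≤ 1 := by
  induction l with
  | nil => simp [expProd]
  | cons y l ih =>
    rw [List.forall_mem_cons] at hl
    exact (norm_mul_le _ _).trans (mul_le_one₀ (ih hl.2) (norm_nonneg _) (hl.1 t))

theorem analyticAt_expProd [CompleteSpace 𝔸] (l : List 𝔸) (t : ℝ) :
    AnalyticAt ℝ (expProd l) t := by
  induction l with
  | nil => exact analyticAt_const
  | cons y l ih => exact ih.mul (analyticAt_exp_smul y t)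

theorem hasDerivAt_expProd [CompleteSpace 𝔸] (l : List 𝔸) (t : ℝ) :
    HasDerivAt (expProd l) (expProd l t * generator l t) t := by
  induction l with
  | nil =>
    rw [generator, mul_zero]
    exact hasDerivAt_const t (1 : 𝔸)
  | cons y l ih =>
    refine (ih.fun_mul (hasDerivAt_exp_smul_const' (𝕂 := ℝ) y t)).congr_deriv ?_
    have h : exp (t • y) * y = y * exp (t • y) :=
      (((Commute.refl y).smul_left t).exp_left).eq
    simp only [expProd, generator, mul_add, mul_assoc]
    rw [← mul_assoc (exp (t • y)) (exp (-(t • y))), exp_mul_exp_neg, one_mul, h, add_comm]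

theorem generator_zero (l : List 𝔸) : generator l 0 = l.sum := by
  induction l with
  | nil => rfl
  | cons y l ih => simp [generator, ih]

/-- Taylor expansion of a conjugation. -/
theorem IsContractive.norm_conj_sub_sum_le [CompleteSpace 𝔸] {y : 𝔸} (hy : IsContractive y)
    (n : ℕ) (c : 𝔸) {t : ℝ} (ht : 0 ≤ t) :
    ‖exp (-(t • y)) * c * exp (t • y) -
      ∑ i ∈ Finset.range n, (t ^ i * (i.factorial⁻¹ : ℝ)) • ((-comm y) ^ i) c‖ ≤
      t ^ n * ‖((comm y) ^ n) c‖ := by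
  induction n generalizing c t with
  | zero => simpa using hy.norm_conj_le t c
  | succ n ih =>
    set φ : ℝ → 𝔸 := fun t => exp (-(t • y)) * c * exp (t • y) -
      ∑ i ∈ Finset.range (n + 1), (t ^ i * (i.factorial⁻¹ : ℝ)) • ((-comm y) ^ i) c with hφ
    have hd : ∀ s : ℝ, HasDerivAt φ (exp (-(s • y)) * ((-comm y) c) * exp (s • y) -
        ∑ i ∈ Finset.range n,
          (s ^ i * (i.factorial⁻¹ : ℝ)) • ((-comm y) ^ i) ((-comm y) c)) s := by
      intro s
      have h1 := ((hasDerivAt_exp_neg_smul y s).mul_const c).mul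
        (hasDerivAt_exp_smul_const' (𝕂 := ℝ) y s)
      have h2 : HasDerivAt (fun t : ℝ =>
          ∑ i ∈ Finset.range (n + 1), (t ^ i * (i.factorial⁻¹ : ℝ)) • ((-comm y) ^ i) c)
          (∑ i ∈ Finset.range (n + 1),
            ((i * s ^ (i - 1)) * (i.factorial⁻¹ : ℝ)) • ((-comm y) ^ i) c) s :=
        HasDerivAt.fun_sum fun i _ => ((hasDerivAt_pow i s).mul_const _).smul_const _
      refine (h1.sub h2).congr_deriv ?_
      congr 1
      · have h : y * exp (-(s • y)) = exp (-(s • y)) * y :=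
          ((((Commute.refl y).smul_right s).neg_right).exp_right).eq
        simp only [LinearMap.neg_apply, comm_apply, h]
        noncomm_ring
      · rw [Finset.sum_range_succ']
        simp only [Nat.cast_zero, zero_mul, zero_smul, add_zero]
        refine Finset.sum_congr rfl fun i _ => ?_
        rw [pow_succ, Module.End.mul_apply]
        congr 1
        rw [Nat.factorial_succ, Nat.add_sub_cancel]
        push_cast
        field_simp
    -- The derivative of the remainder is the remainder of one order less for `[-y, c]`, so the mean
    -- value inequality closes the induction. The `1/n!` is given up.
    have h0 : φ 0 = 0 := by
      simp [hφ, Finset.sum_range_succ']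
    have hb := norm_image_sub_le_of_norm_deriv_le_segment' (f := φ) (a := 0) (b := t)
      (C := t ^ n * ‖((comm y) ^ (n + 1)) c‖) (fun x _ => (hd x).hasDerivWithinAt)
      (fun x hx => by
        refine (ih ((-comm y) c) hx.1).trans ?_
        rw [LinearMap.neg_apply, map_neg, norm_neg, ← Module.End.mul_apply, ← pow_succ]
        gcongr
        · exact hx.1
        · exact hx.2.le) t ⟨ht, le_rfl⟩
    rw [h0, sub_zero, sub_zero] at hb
    exact hb.trans_eq (by ring)

/-! ### Nested commutators and the Taylor remainder of the generator -/

/-- The sum of the values of a seminorm at the commutators with all elements of a list. -/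
def commSeminorm (l : List 𝔸) (f : Seminorm ℝ 𝔸) : Seminorm ℝ 𝔸 :=
  (l.map fun y => f.comp (comm y)).sum

@[simp] theorem commSeminorm_nil (f : Seminorm ℝ 𝔸) : commSeminorm [] f = 0 := rfl

@[simp] theorem commSeminorm_cons (y : 𝔸) (l : List 𝔸) (f : Seminorm ℝ 𝔸) :
    commSeminorm (y :: l) f = f.comp (comm y) + commSeminorm l f := rfl

theorem commSeminorm_apply (l : List 𝔸) (f : Seminorm ℝ 𝔸) (c : 𝔸) :
    commSeminorm l f c = (l.map fun y => f (comm y c)).sum := by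
  induction l with
  | nil => rfl
  | cons y l ih => simp [ih]

theorem commSeminorm_mono (l : List 𝔸) {f g : Seminorm ℝ 𝔸} (h : f ≤ g) :
    commSeminorm l f ≤ commSeminorm l g := by
  intro c
  simp only [commSeminorm_apply]
  exact List.sum_le_sum fun y _ => h _

theorem commSeminorm_iterate_mono (l : List 𝔸) (k : ℕ) {f g : Seminorm ℝ 𝔸} (h : f ≤ g) :
    (commSeminorm l)^[k] f ≤ (commSeminorm l)^[k] g := by
  induction k generalizing f g with
  | zero => exact h
  | succ k ih => exact ih (commSeminorm_mono l h)

theorem commSeminorm_add (l : List 𝔸) (f g : Seminorm ℝ 𝔸) :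
    commSeminorm l (f + g) = commSeminorm l f + commSeminorm l g := by
  ext c
  simp only [commSeminorm_apply, add_apply]
  exact List.sum_map_add

theorem commSeminorm_iterate_add (l : List 𝔸) (k : ℕ) (f g : Seminorm ℝ 𝔸) :
    (commSeminorm l)^[k] (f + g) = (commSeminorm l)^[k] f + (commSeminorm l)^[k] g := by
  induction k generalizing f g with
  | zero => rfl
  | succ k ih => simp only [Function.iterate_succ_apply, commSeminorm_add, ih]

/-- The left side keeps, among the words of `k` commutators over `x :: l`, only those whose
`x`-commutators are all outermost. The other words contribute nonnegative amounts. -/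
theorem sum_iterate_le_iterate_cons (x : 𝔸) (l : List 𝔸) (k : ℕ) (f : Seminorm ℝ 𝔸) (c : 𝔸) :
    ∑ j ∈ Finset.range (k + 1), (commSeminorm l)^[j] (f.comp (comm x ^ (k - j))) c ≤
      (commSeminorm (x :: l))^[k] f c := by
  induction k generalizing f with
  | zero => simp [Module.End.one_eq_id]
  | succ k ih =>
    rw [Finset.sum_range_succ, Function.iterate_succ_apply (commSeminorm (x :: l)),
      commSeminorm_cons,
      commSeminorm_iterate_add, add_apply]
    refine add_le_add ?_ ?_
    · refine le_trans (Finset.sum_le_sum fun j hj => ?_) (ih (f.comp (comm x)))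
      have hj' : k + 1 - j = (k - j) + 1 := by
        have := Finset.mem_range.1 hj
        omega
      rw [hj', pow_succ', Module.End.mul_eq_comp]
      exact le_of_eq (by rfl)
    · have h1 : (commSeminorm l)^[k + 1] (f.comp (comm x ^ (k + 1 - (k + 1)))) c =
          (commSeminorm l)^[k] (commSeminorm l f) c := by
        simp [Module.End.one_eq_id]
      rw [h1]
      have h2 : ∀ g : Seminorm ℝ 𝔸, (commSeminorm l)^[k] g ≤ (commSeminorm (x :: l))^[k] g := by
        intro g
        clear ih h1
        induction k generalizing g with
        | zero => exact le_rfl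
        | succ k ih =>
          rw [Function.iterate_succ_apply, Function.iterate_succ_apply]
          refine (ih _).trans (commSeminorm_iterate_mono _ _ fun c => ?_)
          simp
      exact h2 _ c

/-- The sum of the values of a seminorm at all `k`-fold commutators of elements of a list. -/
def commBound (l : List 𝔸) (k : ℕ) (f : Seminorm ℝ 𝔸) : ℝ :=
  (l.map fun y => (commSeminorm l)^[k] f y).sum

theorem commBound_nonneg (l : List 𝔸) (k : ℕ) (f : Seminorm ℝ 𝔸) : 0 ≤ commBound l k f :=
  List.sum_nonneg fun _ h => by
    obtain ⟨y, -, rfl⟩ := List.mem_map.1 h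
    exact apply_nonneg _ _

theorem sum_listSum {ι α : Type*} (s : Finset ι) (l : List α) (g : ι → α → ℝ) :
    ∑ j ∈ s, (l.map (g j)).sum = (l.map fun y => ∑ j ∈ s, g j y).sum := by
  induction l with
  | nil => simp
  | cons y l ih => simp [Finset.sum_add_distrib, ih]

/-- Mirrors the recursion of `generatorCoeff`. It is the induction step for both the coefficients
and the remainder. -/
theorem le_commBound_cons (x : 𝔸) (l : List 𝔸) (k : ℕ) (f : Seminorm ℝ 𝔸) :
    (if k = 0 then f x else 0) +
      ∑ j ∈ Finset.range (k + 1), commBound l j (f.comp (comm x ^ (k - j))) ≤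
      commBound (x :: l) k f := by
  rw [commBound, List.map_cons, List.sum_cons]
  refine add_le_add ?_ ?_
  · split_ifs with h
    · subst h
      exact le_rfl
    · exact apply_nonneg _ _
  · simp only [commBound]
    rw [sum_listSum]
    exact List.sum_le_sum fun y _ => sum_iterate_le_iterate_cons x l k f y

/-- General seminorms are needed even if only the norm matters in the end: the induction on the list
passes from `f` to `f ∘ (ad x)^(k - j)`. -/
theorem seminorm_generatorCoeff_le (l : List 𝔸) (k : ℕ) (f : Seminorm ℝ 𝔸) :
    f (generatorCoeff l k) ≤ commBound l k f := by
  induction l generalizing k f with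
  | nil => simp [generatorCoeff, commBound]
  | cons x l ih =>
    refine le_trans ?_ (le_commBound_cons x l k f)
    rw [generatorCoeff]
    refine (map_add_le_add f _ _).trans (add_le_add ?_ ?_)
    · split_ifs <;> simp
    · refine (Finset.le_sum_of_subadditive f (map_zero f).le (map_add_le_add f) _ _).trans
        (Finset.sum_le_sum fun j _ => ?_)
      refine le_trans ?_ (ih j (f.comp (comm x ^ (k - j))))
      rw [map_smul_eq_mul, Seminorm.comp_apply, neg_pow, Module.End.mul_apply]
      have h1 : f (((-1 : Module.End ℝ 𝔸) ^ (k - j)) ((comm x ^ (k - j)) (generatorCoeff l j)))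
          = f ((comm x ^ (k - j)) (generatorCoeff l j)) := by
        rcases neg_one_pow_eq_or (Module.End ℝ 𝔸) (k - j) with h | h <;> rw [h] <;> simp
      rw [h1]
      refine mul_le_of_le_one_left (apply_nonneg _ _) ?_
      rw [norm_inv, Real.norm_natCast]
      exact inv_le_one_of_one_le₀ (by exact_mod_cast Nat.factorial_pos _)

/-- The norm, as a seminorm. -/
abbrev nrm : Seminorm ℝ 𝔸 := normSeminorm ℝ 𝔸

/-- Taylor expansion of the generator, with an error in terms of commutators. -/
theorem norm_generator_sub_sum_le [CompleteSpace 𝔸] {l : List 𝔸}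
    (hl : ∀ y ∈ l, IsContractive y) (p : ℕ) {t : ℝ} (ht : 0 ≤ t) :
    ‖generator l t - ∑ k ∈ Finset.range p, t ^ k • generatorCoeff l k‖ ≤
      t ^ p * commBound l p nrm := by
  induction l with
  | nil => simp [generator, generatorCoeff, commBound]
  | cons x l ih =>
    rw [List.forall_mem_cons] at hl
    have hx := hl.1
    specialize ih hl.2
    set E : 𝔸 → 𝔸 := fun c => exp (-(t • x)) * c * exp (t • x) with hE
    have hsum : ∑ k ∈ Finset.range p, t ^ k • generatorCoeff (x :: l) k =
        (if p = 0 then 0 else x) + ∑ j ∈ Finset.range p, t ^ j •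
          ∑ i ∈ Finset.range (p - j), (t ^ i * (i.factorial⁻¹ : ℝ)) •
            ((-comm x) ^ i) (generatorCoeff l j) := by
      simp only [generatorCoeff, smul_add, Finset.sum_add_distrib]
      congr 1
      · cases p with
        | zero => simp
        | succ p => simp
      · simp only [Finset.smul_sum, smul_smul]
        rw [← Finset.sum_range_diag_flip p (fun j i => (t ^ j * (t ^ i * (i.factorial⁻¹ : ℝ))) •
            ((-comm x) ^ i) (generatorCoeff l j))]
        refine Finset.sum_congr rfl fun k _ => Finset.sum_congr rfl fun j hj => ?_
        rw [← mul_assoc, ← pow_add,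
          Nat.add_sub_cancel' (Nat.lt_succ_iff.1 (Finset.mem_range.1 hj))]
    have hEsum : E (∑ k ∈ Finset.range p, t ^ k • generatorCoeff l k) =
        ∑ k ∈ Finset.range p, t ^ k • E (generatorCoeff l k) := by
      simp [hE, Finset.mul_sum, Finset.sum_mul]
    -- Two errors: the conjugated remainder of the tail, and for each tail coefficient of degree `j`
    -- the conjugation truncated at degree `p - j`. The term with `p = 0` is the head, which no
    -- polynomial has yet removed.
    have hdecomp : generator (x :: l) t - ∑ k ∈ Finset.range p, t ^ k • generatorCoeff (x :: l) k =
        (if p = 0 then x else 0) +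
        (E (generator l t - ∑ k ∈ Finset.range p, t ^ k • generatorCoeff l k) +
        ∑ j ∈ Finset.range p, t ^ j • (E (generatorCoeff l j) -
          ∑ i ∈ Finset.range (p - j), (t ^ i * (i.factorial⁻¹ : ℝ)) •
            ((-comm x) ^ i) (generatorCoeff l j))) := by
      have hsub : ∀ a b, E (a - b) = E a - E b := fun a b => by simp [hE, mul_sub, sub_mul]
      rw [hsum, hsub, hEsum]
      simp only [smul_sub, Finset.sum_sub_distrib, generator]
      split_ifs <;> abel
    rw [hdecomp]
    have hle := mul_le_mul_of_nonneg_left (le_commBound_cons x l p nrm) (pow_nonneg ht p)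
    refine le_trans ?_ hle
    -- The summand `j = p` pays for the remainder of the tail, those with `j < p` for the truncated
    -- conjugations.
    rw [mul_add, Finset.sum_range_succ, mul_add, add_comm (t ^ p * Finset.sum _ _)]
    refine (norm_add_le _ _).trans (add_le_add ?_ ((norm_add_le _ _).trans (add_le_add ?_ ?_)))
    · split_ifs with h
      · simp [h]
      · simp
    · refine (hx.norm_conj_le t _).trans (ih.trans_eq ?_)
      simp [Module.End.one_eq_id]
    · rw [Finset.mul_sum]
      refine norm_sum_le_of_le _ fun j hj => ?_
      rw [norm_smul, Real.norm_of_nonneg (pow_nonneg ht j)]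
      calc _ ≤ t ^ j * (t ^ (p - j) * ‖((comm x) ^ (p - j)) (generatorCoeff l j)‖) :=
            mul_le_mul_of_nonneg_left (hx.norm_conj_sub_sum_le _ _ ht) (pow_nonneg ht j)
        _ = t ^ p * (nrm.comp (comm x ^ (p - j))) (generatorCoeff l j) := by
            rw [← mul_assoc, ← pow_add, Nat.add_sub_cancel' (Finset.mem_range.1 hj).le]
            rfl
        _ ≤ _ := mul_le_mul_of_nonneg_left (seminorm_generatorCoeff_le l j _) (pow_nonneg ht p)

end BanachAlgebra

end TrotterError

namespace TrotterError

set_option linter.unusedSectionVars false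

open NormedSpace Filter Topology Asymptotics

/-! ### Orders of vanishing of analytic functions and polynomials -/

section Order

variable {E : Type*} [NormedAddCommGroup E] [NormedSpace ℝ E]

theorem isBigO_of_pow_smul {g : ℝ → E} {l : Filter ℝ} (hl : l ≤ 𝓝[≠] 0) {n m : ℕ}
    (h : (fun t : ℝ => t ^ n • g t) =O[l] fun t => t ^ (n + m)) : g =O[l] fun t => t ^ m := by
  obtain ⟨C, hC⟩ := h.bound
  refine IsBigO.of_bound C ?_
  filter_upwards [hC, hl self_mem_nhdsWithin] with t ht ht0
  have hpos : 0 < ‖t ^ n‖ := norm_pos_iff.2 (pow_ne_zero n ht0)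
  rw [norm_smul, pow_add, norm_mul, mul_left_comm] at ht
  exact le_of_mul_le_mul_left ht hpos

theorem isBigO_pow_of_le {m n : ℕ} (h : m ≤ n) :
    (fun t : ℝ => t ^ n) =O[𝓝 0] fun t : ℝ => t ^ m := by
  obtain ⟨k, rfl⟩ := Nat.exists_eq_add_of_le h
  have h1 : (fun t : ℝ => t ^ k) =O[𝓝 0] fun _ => (1 : ℝ) :=
    (continuous_pow k).continuousAt.isBigO_one ℝ
  simpa [pow_add] using (isBigO_refl (fun t : ℝ => t ^ m) (𝓝 0)).mul h1

theorem tendsto_zero_of_isBigO_pow_succ {g : ℝ → E} {l : Filter ℝ} (hl : l ≤ 𝓝 0) {m : ℕ}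
    (h : g =O[l] fun t => t ^ (m + 1)) : Tendsto g l (𝓝 0) := by
  refine h.trans_tendsto ?_
  have : Tendsto (fun t : ℝ => t ^ (m + 1)) (𝓝 0) (𝓝 (0 ^ (m + 1))) :=
    (continuous_pow (m + 1)).tendsto 0
  rw [zero_pow (Nat.succ_ne_zero m)] at this
  exact this.mono_left hl

theorem exists_eq_smul_of_apply_zero [CompleteSpace E] {g : ℝ → E} (hg : AnalyticAt ℝ g 0)
    (h0 : g 0 = 0) : ∃ g' : ℝ → E, AnalyticAt ℝ g' 0 ∧ ∀ᶠ t in 𝓝 (0 : ℝ), g t = t • g' t := by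
  have h1 : ((1 : ℕ) : ℕ∞) ≤ analyticOrderAt g 0 := by
    rw [Nat.cast_one, Order.one_le_iff_ne_zero]
    exact analyticOrderAt_ne_zero.2 ⟨hg, h0⟩
  simpa using (natCast_le_analyticOrderAt hg).1 h1

/-- One power is divided out at a time: the estimate on the punctured neighbourhood makes the
quotient tend to zero, and continuity makes it vanish at zero. -/
theorem exists_eq_pow_smul_of_isBigO [CompleteSpace E] {f : ℝ → E} (hf : AnalyticAt ℝ f 0) {n : ℕ}
    (h : f =O[𝓝 0] fun t : ℝ => t ^ n) :
    ∃ g : ℝ → E, AnalyticAt ℝ g 0 ∧ ∀ᶠ t in 𝓝 (0 : ℝ), f t = t ^ n • g t := by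
  induction n with
  | zero => exact ⟨f, hf, by simp⟩
  | succ n ih =>
    obtain ⟨g, hg, hfg⟩ := ih (h.trans (isBigO_pow_of_le n.le_succ))
    have h1 : g =O[𝓝[≠] 0] fun t : ℝ => t ^ (0 + 1) := by
      refine isBigO_of_pow_smul (n := n) le_rfl ?_
      rw [zero_add]
      exact (h.congr' hfg EventuallyEq.rfl).mono nhdsWithin_le_nhds
    have h0 : g 0 = 0 := tendsto_nhds_unique
      (hg.continuousAt.tendsto.mono_left nhdsWithin_le_nhds)
      (tendsto_zero_of_isBigO_pow_succ nhdsWithin_le_nhds h1)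
    obtain ⟨g', hg', hgg'⟩ := exists_eq_smul_of_apply_zero hg h0
    refine ⟨g', hg', ?_⟩
    filter_upwards [hfg, hgg'] with t h2 h3
    rw [h2, h3, smul_smul, pow_succ]

/-- The one-sided filter is what is available later, since the generator is estimated for
nonnegative times only. -/
theorem eq_zero_of_sum_pow_smul_isBigO {p : ℕ} {c : ℕ → E}
    (h : (fun t : ℝ => ∑ k ∈ Finset.range p, t ^ k • c k) =O[𝓝[>] 0] fun t => t ^ p) :
    ∀ k < p, c k = 0 := by
  induction p generalizing c with
  | zero => simp
  | succ p ih =>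
    have h0 : c 0 = 0 := by
      have h1 : Tendsto (fun t : ℝ => ∑ k ∈ Finset.range (p + 1), t ^ k • c k) (𝓝[>] 0)
          (𝓝 (∑ k ∈ Finset.range (p + 1), (0 : ℝ) ^ k • c k)) :=
        (Continuous.tendsto (by fun_prop) 0).mono_left nhdsWithin_le_nhds
      have h2 := tendsto_nhds_unique h1 (tendsto_zero_of_isBigO_pow_succ nhdsWithin_le_nhds h)
      simpa [Finset.sum_range_succ'] using h2
    have h3 : (fun t : ℝ => ∑ k ∈ Finset.range p, t ^ k • c (k + 1)) =O[𝓝[>] 0]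
        fun t => t ^ p := by
      refine isBigO_of_pow_smul (n := 1) (nhdsWithin_mono _ fun t ht => ne_of_gt ht) ?_
      rw [add_comm 1 p]
      refine h.congr_left fun t => ?_
      rw [Finset.sum_range_succ', h0, smul_zero, add_zero, Finset.smul_sum]
      refine Finset.sum_congr rfl fun k _ => ?_
      rw [smul_smul, pow_one, pow_succ']
    rintro (_ | k) hk
    · exact h0
    · exact ih h3 k (by omega)

end Order

/-! ### Order conditions for the generator and the resulting error bounds -/

section BanachAlgebra

variable {𝔸 : Type*} [NormedRing 𝔸] [NormedAlgebra ℝ 𝔸]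

theorem generatorCoeff_zero (l : List 𝔸) : generatorCoeff l 0 = l.sum := by
  induction l with
  | nil => rfl
  | cons y l ih => simp [generatorCoeff, ih]

variable [CompleteSpace 𝔸]

theorem hasDerivAt_expProd_mul_exp (l : List 𝔸) (x : 𝔸) (t : ℝ) :
    HasDerivAt (fun s => expProd l s * exp (-(s • x)))
      (expProd l t * (generator l t - x) * exp (-(t • x))) t := by
  refine ((hasDerivAt_expProd l t).fun_mul (hasDerivAt_exp_neg_smul x t)).congr_deriv ?_
  noncomm_ring

/-- The order condition determines the Taylor coefficients of the generator. -/
theorem generatorCoeff_eq_of_isBigO {l : List 𝔸} (hl : ∀ y ∈ l, IsContractive y) {x : 𝔸} {p : ℕ}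
    (h : (fun t : ℝ => expProd l t - exp (t • x)) =O[𝓝 0] fun t : ℝ => t ^ (p + 1)) :
    ∀ k < p, generatorCoeff l k = if k = 0 then x else 0 := by
  set V : ℝ → 𝔸 := fun t => expProd l t * exp (-(t • x)) - 1 with hV
  have hcont : ∀ y : 𝔸, ContinuousAt (fun t : ℝ => exp (t • y)) 0 :=
    fun y => (analyticAt_exp_smul y 0).continuousAt
  have hVan : AnalyticAt ℝ V 0 := by
    refine ((analyticAt_expProd l 0).mul ?_).sub analyticAt_const
    simpa using analyticAt_exp_smul (-x) 0
  have hVO : V =O[𝓝 0] fun t : ℝ => t ^ (p + 1) := by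
    have h1 : (fun t : ℝ => exp (t • (-x))) =O[𝓝 0] fun _ => (1 : ℝ) := (hcont (-x)).isBigO_one ℝ
    refine (h.mul h1).congr (fun t => ?_) (fun t => mul_one _)
    rw [hV, smul_neg, sub_mul, exp_mul_exp_neg]
  obtain ⟨g, hg, hVg⟩ := exists_eq_pow_smul_of_isBigO hVan hVO
  have hV0 : V 0 = 0 := by simp [hV]
  -- An `O`-estimate cannot be differentiated in general; analyticity of `V` allows it, at the cost
  -- of one order.
  have hord : ((p : ℕ) : ℕ∞) ≤ analyticOrderAt (deriv V) 0 := by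
    rw [analyticOrderAt_deriv_ge_iff hVan hV0]
    exact_mod_cast (natCast_le_analyticOrderAt hVan).2 ⟨g, hg, by simpa using hVg⟩
  obtain ⟨g', hg', hVg'⟩ := (natCast_le_analyticOrderAt hVan.deriv).1 hord
  have hderiv : ∀ t, deriv V t = expProd l t * (generator l t - x) * exp (-(t • x)) := fun t =>
    ((hasDerivAt_expProd_mul_exp l x t).sub_const 1).deriv
  have hSO : (fun t => expProd l t * (generator l t - x)) =O[𝓝 0] fun t : ℝ => t ^ p := by
    have h1 : (fun t : ℝ => t ^ p • g' t) =O[𝓝 0] fun t : ℝ => t ^ p := by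
      simpa using (isBigO_refl (fun t : ℝ => t ^ p) (𝓝 0)).smul (hg'.continuousAt.isBigO_one ℝ)
    have h2 := h1.mul ((hcont x).isBigO_one ℝ)
    refine h2.congr' ?_ (by simp)
    filter_upwards [hVg'] with t ht
    rw [sub_zero, hderiv] at ht
    rw [← ht, mul_assoc, exp_neg_mul_exp, mul_one]
  have hgO : (fun t => generator l t - x) =O[𝓝 0] fun t : ℝ => t ^ p := by
    -- Near zero `‖𝒮(t) - 1‖ ≤ 1/2`, so left multiplication by `𝒮(t)` shrinks norms at most by the
    -- factor 2.
    refine IsBigO.trans (IsBigO.of_bound 2 ?_) hSO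
    have h1 : Tendsto (fun t => ‖expProd l t - 1‖) (𝓝 0) (𝓝 0) := by
      have := (((analyticAt_expProd l 0).continuousAt.tendsto).sub_const 1).norm
      simpa using this
    filter_upwards [h1.eventually_le_const (show (0 : ℝ) < 1 / 2 by norm_num)] with t ht
    set z := generator l t - x
    have h2 : ‖z‖ ≤ ‖expProd l t * z‖ + ‖expProd l t - 1‖ * ‖z‖ := by
      calc ‖z‖ = ‖expProd l t * z - (expProd l t - 1) * z‖ := by
            congr 1
            noncomm_ring
        _ ≤ _ := (norm_sub_le _ _).trans (by gcongr; exact norm_mul_le _ _)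
    nlinarith [norm_nonneg z]
  have hPO : (fun t : ℝ => ∑ k ∈ Finset.range p,
      t ^ k • (generatorCoeff l k - if k = 0 then x else 0)) =O[𝓝[>] 0] fun t => t ^ p := by
    rcases Nat.eq_zero_or_pos p with rfl | hp
    · simpa only [Finset.range_zero, Finset.sum_empty] using isBigO_zero _ _
    have h1 : (fun t : ℝ => generator l t - ∑ k ∈ Finset.range p, t ^ k • generatorCoeff l k)
        =O[𝓝[>] 0] fun t => t ^ p := by
      refine IsBigO.of_bound (commBound l p nrm) ?_
      filter_upwards [self_mem_nhdsWithin] with t (ht : 0 < t)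
      rw [Real.norm_of_nonneg (pow_nonneg ht.le p), mul_comm]
      exact norm_generator_sub_sum_le hl p ht.le
    refine ((hgO.mono nhdsWithin_le_nhds).sub h1).congr_left fun t => ?_
    have h2 : ∑ k ∈ Finset.range p, t ^ k • (if k = 0 then x else 0) = x := by
      rw [Finset.sum_eq_single_of_mem 0 (by simpa using hp) (fun k _ hk => by simp [hk])]
      simp
    simp only [smul_sub, Finset.sum_sub_distrib, h2]
    abel
  exact fun k hk => sub_eq_zero.1 (eq_zero_of_sum_pow_smul_isBigO hPO k hk)

theorem sum_eq_of_isBigO {l : List 𝔸} (hl : ∀ y ∈ l, IsContractive y) {x : 𝔸} {p : ℕ}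
    (hp : 1 ≤ p)
    (h : (fun t : ℝ => expProd l t - exp (t • x)) =O[𝓝 0] fun t : ℝ => t ^ (p + 1)) :
    l.sum = x := by
  simpa [generatorCoeff_zero] using generatorCoeff_eq_of_isBigO hl h 0 hp

/-- The error of a product of exponentials is bounded by that of its generator. -/
theorem norm_expProd_sub_exp_le [NormOneClass 𝔸] {l : List 𝔸} (hl : ∀ y ∈ l, IsContractive y)
    {x : 𝔸} (hx : IsContractive x) {t C : ℝ} (ht : 0 ≤ t)
    (hC : ∀ s, 0 ≤ s → s ≤ t → ‖generator l s - x‖ ≤ C) :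
    ‖expProd l t - exp (t • x)‖ ≤ C * t := by
  have hb := norm_image_sub_le_of_norm_deriv_le_segment'
    (f := fun s => expProd l s * exp (-(s • x))) (a := 0) (b := t) (C := C)
    (fun s _ => (hasDerivAt_expProd_mul_exp l x s).hasDerivWithinAt)
    (fun s hs => by
      calc _ ≤ ‖expProd l s‖ * ‖generator l s - x‖ * ‖exp (-(s • x))‖ := norm_mul₃_le
        _ ≤ 1 * C * 1 := by
          gcongr
          · simpa using (norm_nonneg _).trans (hC s hs.1 hs.2.le)
          · exact norm_expProd_le hl s
          · exact hC s hs.1 hs.2.le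
          · exact hx.norm_exp_neg_le s
        _ = C := by ring) t ⟨ht, le_rfl⟩
  simp only [expProd_zero_right, zero_smul, neg_zero, exp_zero, mul_one, sub_zero] at hb
  calc ‖expProd l t - exp (t • x)‖ = ‖(expProd l t * exp (-(t • x)) - 1) * exp (t • x)‖ := by
        rw [sub_mul, mul_assoc, exp_neg_mul_exp, mul_one, one_mul]
    _ ≤ (C * t) * 1 := (norm_mul_le _ _).trans
        (mul_le_mul hb (hx t) (norm_nonneg _) ((norm_nonneg _).trans hb))
    _ = C * t := mul_one _

/-- Trotter error with commutator scaling. -/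
theorem norm_expProd_sub_exp_le_commBound [NormOneClass 𝔸] {l : List 𝔸}
    (hl : ∀ y ∈ l, IsContractive y) {x : 𝔸} (hx : IsContractive x) {p : ℕ} (hp : 1 ≤ p)
    (h : (fun t : ℝ => expProd l t - exp (t • x)) =O[𝓝 0] fun t : ℝ => t ^ (p + 1))
    {t : ℝ} (ht : 0 ≤ t) :
    ‖expProd l t - exp (t • x)‖ ≤ commBound l p nrm * t ^ (p + 1) := by
  have hsum : ∀ s : ℝ, ∑ k ∈ Finset.range p, s ^ k • generatorCoeff l k = x := by
    intro s
    rw [Finset.sum_eq_single_of_mem 0 (Finset.mem_range.2 hp) (fun k hk hk0 => by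
      rw [generatorCoeff_eq_of_isBigO hl h k (Finset.mem_range.1 hk), if_neg hk0, smul_zero])]
    rw [generatorCoeff_eq_of_isBigO hl h 0 hp]
    simp
  refine (norm_expProd_sub_exp_le hl hx ht (C := t ^ p * commBound l p nrm)
    fun s hs hst => ?_).trans_eq (by ring)
  have := norm_generator_sub_sum_le hl p hs
  rw [hsum] at this
  refine this.trans ?_
  gcongr
  exact commBound_nonneg _ _ _

theorem norm_exp_sub_exp_le [NormOneClass 𝔸] {x y : 𝔸} (hx : IsContractive x)
    (hy : IsContractive y) {t : ℝ} (ht : 0 ≤ t) :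
    ‖exp (t • x) - exp (t • y)‖ ≤ ‖x - y‖ * t := by
  simpa [expProd, generator] using norm_expProd_sub_exp_le (l := [x]) (by simpa using hx) hy ht
    (C := ‖x - y‖) (fun s _ _ => by simp [generator])

/-- Factors are exchanged one by one; contractivity of the others makes the errors add. -/
theorem norm_expProd_map_sub_le [NormOneClass 𝔸] {ι : Type*} (l : List ι) {f g : ι → 𝔸}
    (hf : ∀ i, IsContractive (f i)) (hg : ∀ i, IsContractive (g i)) {t : ℝ} (ht : 0 ≤ t) :
    ‖expProd (l.map f) t - expProd (l.map g) t‖ ≤ (l.map fun i => ‖f i - g i‖).sum * t := by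
  induction l with
  | nil => simp [expProd]
  | cons i l ih =>
    simp only [List.map_cons, expProd, List.sum_cons]
    calc _ = ‖expProd (l.map f) t * (exp (t • f i) - exp (t • g i)) +
          (expProd (l.map f) t - expProd (l.map g) t) * exp (t • g i)‖ := by
          congr 1
          noncomm_ring
      _ ≤ 1 * (‖f i - g i‖ * t) + ((l.map fun i => ‖f i - g i‖).sum * t) * 1 := by
          refine (norm_add_le _ _).trans (add_le_add ?_ ?_)
          · refine (norm_mul_le _ _).trans (mul_le_mul ?_ (norm_exp_sub_exp_le (hf i) (hg i) ht)
              (norm_nonneg _) zero_le_one)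
            exact norm_expProd_le (by simpa using fun i _ => hf i) t
          · exact (norm_mul_le _ _).trans (mul_le_mul ih (hg i t) (norm_nonneg _)
              ((norm_nonneg _).trans ih))
      _ = _ := by ring

theorem expProd_map_smul {ι : Type*} (l : List ι) (c : ι → ℝ) (x : 𝔸) (t : ℝ) :
    expProd (l.map fun i => c i • x) t = exp (t • ((l.map c).sum • x)) := by
  induction l with
  | nil => simp [expProd]
  | cons i l ih =>
    simp only [List.map_cons, expProd, ih, List.sum_cons, smul_smul]
    rw [← exp_add_smul]
    congr 2
    ring

theorem norm_list_sum_le {ι : Type*} (l : List ι) (f : ι → 𝔸) :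
    ‖(l.map f).sum‖ ≤ (l.map fun i => ‖f i‖).sum := by
  induction l with
  | nil => simp
  | cons i l ih =>
    simp only [List.map_cons, List.sum_cons]
    exact (norm_add_le _ _).trans (by gcongr)

theorem sum_map_sub_smul {ι : Type*} (l : List ι) (f : ι → 𝔸) (c : ι → ℝ) (x : 𝔸) :
    (l.map fun i => f i - c i • x).sum = (l.map f).sum - (l.map c).sum • x := by
  induction l with
  | nil => simp
  | cons i l ih =>
    simp only [List.map_cons, List.sum_cons, ih, add_smul]
    abel

/-- Trotter error when all exponents are close to multiples of one operator. -/
theorem norm_expProd_sub_exp_sum_le [NormOneClass 𝔸] {ι : Type*} (l : List ι) {f : ι → 𝔸}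
    (hf : ∀ i, IsContractive (f i)) (hsum : IsContractive (l.map f).sum) (c : ι → ℝ) {x : 𝔸}
    (hx : IsContractive x) {t : ℝ} (ht : 0 ≤ t) :
    ‖expProd (l.map f) t - exp (t • (l.map f).sum)‖ ≤
      2 * (l.map fun i => ‖f i - c i • x‖).sum * t := by
  -- The exponents `c i • x` commute, so their product is a single exponential. The factor 2 arises
  -- from changing the factors here and the sum of the exponents in `h2`.
  have h1 := norm_expProd_map_sub_le l hf (fun i => hx.smul (c i)) ht
  rw [expProd_map_smul] at h1
  have h2 := norm_exp_sub_exp_le (hx.smul (l.map c).sum) hsum ht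
  have h3 : ‖(l.map c).sum • x - (l.map f).sum‖ ≤ (l.map fun i => ‖f i - c i • x‖).sum := by
    rw [norm_sub_rev]
    rw [← sum_map_sub_smul]
    exact norm_list_sum_le l fun i => f i - c i • x
  calc _ ≤ _ := norm_sub_le_norm_sub_add_norm_sub _ _ _
    _ ≤ _ := add_le_add h1 (h2.trans (mul_le_mul_of_nonneg_right h3 ht))
    _ = _ := by ring

/-! ### Calculus of leading error coefficients -/

/-- `Φ t = exp (t a x) + t ^ n e + O(t ^ (n + 1))`, with an analytic remainder. -/
def ExpExpansion (x : 𝔸) (n : ℕ) (a : ℝ) (e : 𝔸) (Φ : ℝ → 𝔸) : Prop :=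
  ∃ g : ℝ → 𝔸, AnalyticAt ℝ g 0 ∧ g 0 = e ∧ ∀ᶠ t in 𝓝 0, Φ t = exp ((t * a) • x) + t ^ n • g t

theorem analyticAt_exp_mul_smul (x : 𝔸) (a : ℝ) :
    AnalyticAt ℝ (fun t : ℝ => exp ((t * a) • x)) 0 := by
  simpa [smul_smul] using analyticAt_exp_smul (a • x) 0

theorem analyticAt_pow_smul {g : ℝ → 𝔸} (hg : AnalyticAt ℝ g 0) (n : ℕ) :
    AnalyticAt ℝ (fun t : ℝ => t ^ n • g t) 0 :=
  ((analyticAt_id (𝕜 := ℝ)).pow n).smul hg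

/-- Leading errors add because the exponentials are 1 at time zero and the product of the errors
carries an extra `t ^ n`. -/
theorem ExpExpansion.mul {x : 𝔸} {n : ℕ} {a b : ℝ} {e e' : 𝔸} {Φ Ψ : ℝ → 𝔸} (hn : n ≠ 0)
    (h : ExpExpansion x n a e Φ) (h' : ExpExpansion x n b e' Ψ) :
    ExpExpansion x n (a + b) (e + e') (fun t => Φ t * Ψ t) := by
  obtain ⟨g, hg, rfl, hΦ⟩ := h
  obtain ⟨g', hg', rfl, hΨ⟩ := h'
  refine ⟨fun t => g t * exp ((t * b) • x) + exp ((t * a) • x) * g' t + t ^ n • (g t * g' t),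
    ((hg.mul (analyticAt_exp_mul_smul x b)).add ((analyticAt_exp_mul_smul x a).mul hg')).add
      (analyticAt_pow_smul (hg.mul hg') n), by simp [hn], ?_⟩
  filter_upwards [hΦ, hΨ] with t h1 h2
  rw [h1, h2, mul_add t, exp_add_smul]
  simp only [add_mul, mul_add, smul_add, smul_mul_assoc, mul_smul_comm]
  abel

theorem ExpExpansion.scale {x : 𝔸} {n : ℕ} {a : ℝ} {e : 𝔸} {Φ : ℝ → 𝔸}
    (h : ExpExpansion x n a e Φ) (b : ℝ) :
    ExpExpansion x n (b * a) (b ^ n • e) (fun t => Φ (b * t)) := by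
  obtain ⟨g, hg, rfl, hΦ⟩ := h
  have hlin : AnalyticAt ℝ (fun t : ℝ => b * t) 0 := analyticAt_const.mul analyticAt_id
  have h0 : Tendsto (fun t : ℝ => b * t) (𝓝 0) (𝓝 0) := by
    simpa using hlin.continuousAt.tendsto
  refine ⟨fun t => b ^ n • g (b * t), ?_, by simp, ?_⟩
  · exact (analyticAt_const (𝕜 := ℝ) (v := b ^ n)).smul (hg.comp_of_eq hlin (by simp))
  · filter_upwards [h0.eventually hΦ] with t ht
    rw [ht, smul_smul, mul_pow, mul_comm (b ^ n)]
    congr 3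
    ring

theorem ExpExpansion.congr {x : 𝔸} {n : ℕ} {a a' : ℝ} {e e' : 𝔸} {Φ Φ' : ℝ → 𝔸}
    (h : ExpExpansion x n a e Φ) (ha : a = a') (he : e = e') (hΦ : ∀ t, Φ t = Φ' t) :
    ExpExpansion x n a' e' Φ' := by
  rw [← ha, ← he, ← funext hΦ]
  exact h

theorem exists_expExpansion {x : 𝔸} {n : ℕ} {Φ : ℝ → 𝔸} (hΦ : AnalyticAt ℝ Φ 0)
    (h : (fun t : ℝ => Φ t - exp (t • x)) =O[𝓝 0] fun t : ℝ => t ^ n) :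
    ∃ e, ExpExpansion x n 1 e Φ := by
  obtain ⟨g, hg, hfg⟩ := exists_eq_pow_smul_of_isBigO (hΦ.sub (analyticAt_exp_smul x 0)) h
  refine ⟨g 0, g, hg, rfl, ?_⟩
  filter_upwards [hfg] with t ht
  rw [mul_one, ← ht]
  simp

/-- A vanishing leading coefficient gains one power of `t`; both constructions of higher-order
formulas rest on this. -/
theorem ExpExpansion.isBigO {x : 𝔸} {n : ℕ} {Φ : ℝ → 𝔸} (h : ExpExpansion x n 1 0 Φ) :
    (fun t : ℝ => Φ t - exp (t • x)) =O[𝓝 0] fun t : ℝ => t ^ (n + 1) := by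
  obtain ⟨g, hg, h0, hΦ⟩ := h
  obtain ⟨g', hg', hgg'⟩ := exists_eq_smul_of_apply_zero hg h0
  have h1 : (fun t : ℝ => t ^ (n + 1) • g' t) =O[𝓝 0] fun t : ℝ => t ^ (n + 1) := by
    simpa using (isBigO_refl (fun t : ℝ => t ^ (n + 1)) (𝓝 0)).smul
      (hg'.continuousAt.isBigO_one ℝ)
  refine h1.congr' ?_ EventuallyEq.rfl
  filter_upwards [hΦ, hgg'] with t h2 h3
  rw [h2, h3, mul_one, add_sub_cancel_left, smul_smul, pow_succ]

/-- The first-order Trotter formula. -/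
theorem isBigO_expProd_sub_exp_sum (l : List 𝔸) :
    (fun t : ℝ => expProd l t - exp (t • l.sum)) =O[𝓝 0] fun t : ℝ => t ^ (1 + 1) := by
  set D : ℝ → 𝔸 := fun t => expProd l t - exp (t • l.sum) with hD
  have h0 : D 0 = 0 := by simp [hD]
  have hder : HasDerivAt D 0 0 := by
    refine ((hasDerivAt_expProd l 0).fun_sub
      (hasDerivAt_exp_smul_const (𝕂 := ℝ) l.sum 0)).congr_deriv ?_
    simp [generator_zero]
  obtain ⟨g, hg, hDg⟩ := exists_eq_smul_of_apply_zero
    ((analyticAt_expProd l 0).sub (analyticAt_exp_smul l.sum 0)) h0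
  have hg0 : g 0 = 0 := by
    have h1 : HasDerivAt (fun t : ℝ => t • g t) (g 0) 0 := by
      refine ((hasDerivAt_id (0 : ℝ)).smul hg.differentiableAt.hasDerivAt).congr_deriv ?_
      simp
    exact (h1.congr_of_eventuallyEq hDg).unique hder
  refine ExpExpansion.isBigO ⟨g, hg, hg0, ?_⟩
  filter_upwards [hDg] with t ht
  rw [mul_one, pow_one, ← ht]
  simp

/-- Multiplying the expansion of `Φ (-t)` by `Ψ t` on the left and `exp (t • x)` on the right
expresses `Ψ` through `g`; the sign `(-1) ^ n` comes from the time reversal. -/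
theorem ExpExpansion.inverse {x : 𝔸} {n : ℕ} {e : 𝔸} {Φ Ψ : ℝ → 𝔸} (h : ExpExpansion x n 1 e Φ)
    (hΨ : AnalyticAt ℝ Ψ 0) (hΨ0 : Ψ 0 = 1) (hinv : ∀ t, Ψ t * Φ (-t) = 1) :
    ExpExpansion x n 1 (-((-1 : ℝ) ^ n • e)) Ψ := by
  obtain ⟨g, hg, hg0, hΦ⟩ := h.scale (-1)
  refine ⟨fun t => -(Ψ t * g t * exp (t • x)),
    ((hΨ.mul hg).mul (analyticAt_exp_smul x 0)).neg, by simp [hΨ0, hg0], ?_⟩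
  filter_upwards [hΦ] with t ht
  have h1 := hinv t
  rw [show -t = -1 * t by ring, ht] at h1
  have h2 : exp ((t * (-1 * 1)) • x) * exp (t • x) = 1 := by
    simpa using exp_neg_mul_exp (t • x)
  have h3 : exp (t • x) = Ψ t + t ^ n • (Ψ t * g t * exp (t • x)) := by
    calc exp (t • x) = 1 * exp (t • x) := (one_mul _).symm
      _ = Ψ t * (exp ((t * (-1 * 1)) • x) * exp (t • x)) +
          t ^ n • (Ψ t * g t * exp (t • x)) := by
        rw [← h1]
        simp only [mul_add, add_mul, mul_assoc, mul_smul_comm, smul_mul_assoc]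
      _ = _ := by rw [h2, mul_one]
  rw [mul_one, smul_neg, ← sub_eq_add_neg]
  exact eq_sub_of_add_eq h3.symm

end BanachAlgebra

end TrotterError

namespace TrotterError

set_option linter.unusedSectionVars false

open NormedSpace Filter Topology Asymptotics

/-! ### Product formulas: composition, symmetrization and arbitrary order -/

theorem expProd_eq_prod {𝔸 : Type*} [NormedRing 𝔸] [NormedAlgebra ℝ 𝔸] (l : List 𝔸) (t : ℝ) :
    expProd l t = (l.map fun y => exp (t • y)).reverse.prod := by
  induction l with
  | nil => rfl
  | cons y l ih => simp [expProd, ih]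

theorem expProd_flatten {𝔸 : Type*} [NormedRing 𝔸] [NormedAlgebra ℝ 𝔸] (l : List (List 𝔸))
    (t : ℝ) : expProd l.flatten t = (l.map fun k => expProd k t).reverse.prod := by
  induction l with
  | nil => rfl
  | cons k l ih => simp [expProd_append, ih]

theorem expProd_reverse_mul_expProd_neg {𝔸 : Type*} [NormedRing 𝔸] [NormedAlgebra ℝ 𝔸]
    [CompleteSpace 𝔸] (l : List 𝔸) (t : ℝ) : expProd l.reverse t * expProd l (-t) = 1 := by
  induction l with
  | nil => simp [expProd]
  | cons y l ih =>
    simp only [List.reverse_cons, expProd_append, expProd, one_mul]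
    calc _ = exp (t • y) * (expProd l.reverse t * expProd l (-t)) * exp (-t • y) := by
          simp only [mul_assoc]
      _ = 1 := by rw [ih, mul_one, neg_smul, exp_mul_exp_neg]

variable {Υ Υ' Γ : ℕ} {N : Type} [Fintype N] [DecidableEq N]

/-- All exponents of a product formula, in the order in which they are applied. -/
def factors (F : ProductFormula Υ Γ) (X : Fin Γ → Matrix N N ℂ) : List (Matrix N N ℂ) :=
  (List.ofFn fun υ => List.ofFn fun γ => F.coeff υ γ • X (F.perm υ γ)).flatten

theorem eval_eq_expProd (F : ProductFormula Υ Γ) (X : Fin Γ → Matrix N N ℂ) (t : ℝ) :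
    F.eval X t = expProd (factors F X) t := by
  rw [factors, expProd_flatten, ProductFormula.eval, List.map_ofFn]
  congr 2
  refine congrArg List.ofFn (funext fun υ => ?_)
  rw [Function.comp_apply, expProd_eq_prod, List.map_ofFn, ProductFormula.stage]
  congr 2
  refine congrArg List.ofFn (funext fun γ => ?_)
  rw [Function.comp_apply, smul_smul]
  rfl

theorem hasOrder_iff (F : ProductFormula Υ Γ) (X : Fin Γ → Matrix N N ℂ) (p : ℕ) :
    F.HasOrder X p ↔ (fun t : ℝ => expProd (factors F X) t - exp (t • ∑ γ, X γ))
      =O[𝓝 0] fun t : ℝ => t ^ (p + 1) := by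
  simp only [ProductFormula.HasOrder, eval_eq_expProd]
  rfl

theorem factors_eq_map (F : ProductFormula Υ Γ) (X : Fin Γ → Matrix N N ℂ) :
    factors F X = ((List.finRange Υ).flatMap fun υ => (List.finRange Γ).map fun γ => (υ, γ)).map
      fun i => F.coeff i.1 i.2 • X (F.perm i.1 i.2) := by
  simp [factors, List.ofFn_eq_map, List.flatMap, List.map_flatten, Function.comp_def]

theorem sum_map_flatMap_finRange {M : Type*} [AddCommMonoid M] (h : Fin Υ × Fin Γ → M) :
    (((List.finRange Υ).flatMap fun υ => (List.finRange Γ).map fun γ => (υ, γ)).map h).sum =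
      ∑ υ, ∑ γ, h (υ, γ) := by
  simp only [← List.sum_ofFn, List.ofFn_eq_map, List.flatMap, List.map_flatten, List.sum_flatten,
    List.map_map, Function.comp_def]

/-- The formula that applies first `F` and then `G`. -/
def append (F : ProductFormula Υ Γ) (G : ProductFormula Υ' Γ) : ProductFormula (Υ + Υ') Γ where
  coeff := Fin.append F.coeff G.coeff
  perm := Fin.append F.perm G.perm
  coeff_le υ γ := by
    refine Fin.addCases (fun i => ?_) (fun i => ?_) υ
    · simpa using F.coeff_le i γ
    · simpa using G.coeff_le i γ

theorem eval_append (F : ProductFormula Υ Γ) (G : ProductFormula Υ' Γ) (X : Fin Γ → Matrix N N ℂ)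
    (t : ℝ) : (append F G).eval X t = G.eval X t * F.eval X t := by
  have h : (append F G).stage X t = Fin.append (F.stage X t) (G.stage X t) := by
    funext υ
    refine Fin.addCases (fun i => ?_) (fun i => ?_) υ <;>
      simp [ProductFormula.stage, append]
  have h' : (List.ofFn fun υ => (append F G).stage X t υ) =
      (List.ofFn fun υ => F.stage X t υ) ++ List.ofFn fun υ => G.stage X t υ := by
    rw [← List.ofFn_fin_append, h]
  rw [ProductFormula.eval, h', List.reverse_append, List.prod_append]
  rfl

/-- The formula with the time rescaled by `b`. -/
def scale (F : ProductFormula Υ Γ) (b : ℝ) (hb : |b| ≤ 1) : ProductFormula Υ Γ where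
  coeff υ γ := b * F.coeff υ γ
  perm := F.perm
  coeff_le υ γ := by
    rw [abs_mul]
    exact mul_le_one₀ hb (abs_nonneg _) (F.coeff_le υ γ)

theorem eval_scale (F : ProductFormula Υ Γ) (b : ℝ) (hb : |b| ≤ 1) (X : Fin Γ → Matrix N N ℂ)
    (t : ℝ) : (scale F b hb).eval X t = F.eval X (b * t) := by
  have h : ∀ γ υ, t * (b * F.coeff υ γ) = b * t * F.coeff υ γ := fun _ _ => by ring
  simp [ProductFormula.eval, ProductFormula.stage, scale, h]

/-- The formula with all factors in the opposite order. -/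
def reverse (F : ProductFormula Υ Γ) : ProductFormula Υ Γ where
  coeff υ γ := F.coeff υ.rev γ.rev
  perm υ := Fin.revPerm.trans (F.perm υ.rev)
  coeff_le _ _ := F.coeff_le _ _

theorem reverse_ofFn {α : Type*} {n : ℕ} (f : Fin n → α) :
    (List.ofFn f).reverse = List.ofFn fun i => f i.rev := by
  simp [List.ofFn_eq_map, ← List.map_reverse, List.finRange_reverse, Function.comp_def]

theorem factors_reverse (F : ProductFormula Υ Γ) (X : Fin Γ → Matrix N N ℂ) :
    factors (reverse F) X = (factors F X).reverse := by
  rw [factors, factors, List.reverse_flatten, List.map_ofFn, reverse_ofFn]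
  congr 1
  refine congrArg List.ofFn (funext fun υ => ?_)
  rw [Function.comp_apply, reverse_ofFn]
  rfl

/-- The formula of first order, with one stage. -/
def firstOrder (Γ : ℕ) : ProductFormula 1 Γ where
  coeff _ _ := 1
  perm _ := Equiv.refl _
  coeff_le _ _ := by simp

theorem firstOrder_hasOrder (X : Fin Γ → Matrix N N ℂ) : (firstOrder Γ).HasOrder X 1 := by
  rw [hasOrder_iff]
  have hsum : (factors (firstOrder Γ) X).sum = ∑ γ, X γ := by
    simp [factors, firstOrder, List.sum_ofFn]
  rw [← hsum]
  exact isBigO_expProd_sub_exp_sum _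

theorem hasOrder_iff_expExpansion (F : ProductFormula Υ Γ) (X : Fin Γ → Matrix N N ℂ) (p : ℕ) :
    F.HasOrder X p ↔ ∃ e, ExpExpansion (∑ γ, X γ) (p + 1) 1 e (F.eval X) := by
  have h : F.eval X = expProd (factors F X) := funext (eval_eq_expProd F X)
  rw [hasOrder_iff, h]
  refine ⟨exists_expExpansion (analyticAt_expProd _ 0), ?_⟩
  rintro ⟨e, g, hg, -, hΦ⟩
  have h1 : (fun t : ℝ => t ^ (p + 1) • g t) =O[𝓝 0] fun t : ℝ => t ^ (p + 1) := by
    simpa using (isBigO_refl (fun t : ℝ => t ^ (p + 1)) (𝓝 0)).smul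
      (hg.continuousAt.isBigO_one ℝ)
  refine h1.congr' ?_ EventuallyEq.rfl
  filter_upwards [hΦ] with t ht
  rw [ht, mul_one, add_sub_cancel_left]

/-- The index is `p` here and `p + 1` in `hasOrder_iff_expExpansion`: cancelling the leading error
of an order-`p` formula yields order `p + 1`. -/
theorem hasOrder_of_expExpansion {F : ProductFormula Υ Γ} {X : Fin Γ → Matrix N N ℂ} {p : ℕ}
    (h : ExpExpansion (∑ γ, X γ) p 1 0 (F.eval X)) : F.HasOrder X p := by
  rw [hasOrder_iff]
  refine h.isBigO.congr_left fun t => ?_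
  rw [eval_eq_expProd]

/-- A symmetric composition raises an odd order. -/
theorem hasOrder_symmetric {F : ProductFormula Υ Γ} {X : Fin Γ → Matrix N N ℂ} {p : ℕ}
    (hp : Odd p) (h : F.HasOrder X p) (hb : |(1 / 2 : ℝ)| ≤ 1) :
    (append (scale F (1 / 2) hb) (scale (reverse F) (1 / 2) hb)).HasOrder X (p + 1) := by
  obtain ⟨e, he⟩ := (hasOrder_iff_expExpansion F X p).1 h
  have hev : (reverse F).eval X = expProd (factors F X).reverse := by
    funext t
    rw [eval_eq_expProd, factors_reverse]
  -- Since `p + 1` is even, reversal changes the sign of the leading error, and the two half steps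
  -- cancel.
  have hrev : ExpExpansion (∑ γ, X γ) (p + 1) 1 (-e) ((reverse F).eval X) := by
    refine (he.inverse (Ψ := (reverse F).eval X) ?_ ?_ fun t => ?_).congr rfl ?_ fun _ => rfl
    · rw [hev]
      exact analyticAt_expProd _ 0
    · rw [hev, expProd_zero_right]
    · rw [hev, eval_eq_expProd, expProd_reverse_mul_expProd_neg]
    · rw [hp.add_one.neg_one_pow, one_smul]
  refine hasOrder_of_expExpansion ((ExpExpansion.mul p.succ_ne_zero (hrev.scale (1 / 2))
    (he.scale (1 / 2))).congr (by norm_num) (by simp) fun t => ?_)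
  rw [eval_append, eval_scale, eval_scale]

/-- Suzuki's composition raises an even order. -/
theorem hasOrder_suzuki {F : ProductFormula Υ Γ} {X : Fin Γ → Matrix N N ℂ} {p : ℕ} {u v : ℝ}
    (h : F.HasOrder X p) (hu : |u| ≤ 1) (hv : |v| ≤ 1) (h1 : 4 * u + v = 1)
    (h2 : 4 * u ^ (p + 1) + v ^ (p + 1) = 0) :
    (append (append (scale F u hu) (scale F u hu))
      (append (scale F v hv) (append (scale F u hu) (scale F u hu)))).HasOrder X (p + 1) := by
  obtain ⟨e, he⟩ := (hasOrder_iff_expExpansion F X p).1 h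
  have hn := p.succ_ne_zero
  have hU := he.scale u
  have hV := he.scale v
  refine hasOrder_of_expExpansion ((ExpExpansion.mul hn (ExpExpansion.mul hn
    (ExpExpansion.mul hn hU hU) hV) (ExpExpansion.mul hn hU hU)).congr ?_ ?_ fun t => ?_)
  · linarith
  · simp only [← add_smul]
    rw [show u ^ (p + 1) + u ^ (p + 1) + v ^ (p + 1) + (u ^ (p + 1) + u ^ (p + 1)) = 0 by linarith,
      zero_smul]
  · simp only [eval_append, eval_scale]

theorem exists_suzuki_coefficients {p : ℕ} (hp : Even p) (hp1 : 1 ≤ p) :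
    ∃ u v : ℝ, |u| ≤ 1 ∧ |v| ≤ 1 ∧ 4 * u + v = 1 ∧ 4 * u ^ (p + 1) + v ^ (p + 1) = 0 := by
  -- With `u = 1/(4 - s)` and `v = -s u` both equations hold, as `s ^ (p + 1) = 4` and `p + 1` is
  -- odd. The bound `s ≤ 2` is exactly what `|v| ≤ 1` needs.
  set s : ℝ := (4 : ℝ) ^ (1 / ((p + 1 : ℕ) : ℝ)) with hs
  have hs0 : 0 < s := by positivity
  have hsp : s ^ (p + 1) = 4 := by
    rw [hs, one_div]
    exact Real.rpow_inv_natCast_pow (by norm_num) p.succ_ne_zero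
  have hs2 : s ≤ 2 := by
    by_contra! hlt
    have h1 : (2 : ℝ) ^ (p + 1) < s ^ (p + 1) := pow_lt_pow_left₀ hlt (by norm_num) p.succ_ne_zero
    have h2 : (2 : ℝ) ^ 2 ≤ 2 ^ (p + 1) := pow_le_pow_right₀ (by norm_num) (by omega)
    rw [hsp] at h1
    linarith
  have hd : 0 < 4 - s := by linarith
  refine ⟨1 / (4 - s), -(s / (4 - s)), ?_, ?_, ?_, ?_⟩
  · rw [abs_of_pos (by positivity), div_le_one hd]
    linarith
  · rw [abs_neg, abs_of_pos (by positivity), div_le_one hd]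
    linarith
  · field_simp
    ring
  · rw [(hp.add_one).neg_pow, div_pow, div_pow, hsp]
    ring

/-- Product formulas of any order, with a number of stages that depends on the order only. -/
theorem exists_productFormula {p : ℕ} (hp : 1 ≤ p) :
    ∃ Υ : ℕ, ∀ Γ : ℕ, ∃ F : ProductFormula Υ Γ, ∀ (N : Type) [Fintype N] [DecidableEq N]
      (X : Fin Γ → Matrix N N ℂ), F.HasOrder X p := by
  induction p, hp using Nat.le_induction with
  | base => exact ⟨1, fun Γ => ⟨firstOrder Γ, fun N _ _ X => firstOrder_hasOrder X⟩⟩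
  | succ p hp ih =>
    obtain ⟨Υ, hΥ⟩ := ih
    choose F hF using hΥ
    rcases Nat.even_or_odd p with he | ho
    · obtain ⟨u, v, hu, hv, h1, h2⟩ := exists_suzuki_coefficients he hp
      exact ⟨_, fun Γ => ⟨_, fun N _ _ X => hasOrder_suzuki (hF Γ N X) hu hv h1 h2⟩⟩
    · have hb : |(1 / 2 : ℝ)| ≤ 1 := by norm_num [abs_of_pos]
      exact ⟨_, fun Γ => ⟨_, fun N _ _ X => hasOrder_symmetric ho (hF Γ N X) hb⟩⟩

end TrotterError

namespace TrotterError

set_option linter.unusedSectionVars false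

open NormedSpace Filter Topology Asymptotics

/-! ### Supports and commutation of local operators -/

section Locality

variable {n : ℕ}

/-- Only the intermediate state that agrees with `y` on `S` and with `x` elsewhere contributes. The
result is symmetric in the two operators, hence they commute. -/
theorem mul_apply_of_actsOnlyOn {S S' : Finset (Fin n)} (hS : Disjoint S S') {T T' : QubitOperator n}
    {M : Matrix (S → Fin 2) (S → Fin 2) ℂ} {M' : Matrix (S' → Fin 2) (S' → Fin 2) ℂ}
    (hM : ∀ x y, T x y =
      if ∀ q, q ∉ S → x q = y q then M (fun q => x q) (fun q => y q) else 0)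
    (hM' : ∀ x y, T' x y =
      if ∀ q, q ∉ S' → x q = y q then M' (fun q => x q) (fun q => y q) else 0)
    (x y : Fin n → Fin 2) :
    (T * T') x y = if ∀ q, q ∉ S → q ∉ S' → x q = y q then
      M (fun q => x q) (fun q => y q) * M' (fun q => x q) (fun q => y q) else 0 := by
  classical
  rw [Finset.disjoint_left] at hS
  rw [Matrix.mul_apply, Finset.sum_eq_single (fun q => if q ∈ S then y q else x q)]
  · have h1 : ∀ q, q ∉ S → x q = if q ∈ S then y q else x q := fun q hq => by simp [hq]
    have h2 : (fun q : S => if (q : Fin n) ∈ S then y q else x q) = fun q : S => y q := by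
      funext q
      simp
    have h3 : (fun q : S' => if (q : Fin n) ∈ S then y q else x q) = fun q : S' => x q := by
      funext q
      rw [if_neg fun h => hS h q.2]
    have h4 : (∀ q, q ∉ S' → (if q ∈ S then y q else x q) = y q) ↔
        ∀ q, q ∉ S → q ∉ S' → x q = y q := by
      refine ⟨fun h q hq hq' => by simpa [hq] using h q hq', fun h q hq' => ?_⟩
      split_ifs with hq
      · rfl
      · exact h q hq hq'
    rw [hM, hM', if_pos h1, h2, h3]
    simp only [h4]
    split_ifs
    · rfl
    · rw [mul_zero]
  · intro z _ hz
    rw [hM, hM']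
    by_cases h1 : ∀ q, q ∉ S → x q = z q
    · by_cases h2 : ∀ q, q ∉ S' → z q = y q
      · refine absurd (funext fun q => ?_) hz
        split_ifs with hq
        · exact h2 q (hS hq)
        · exact (h1 q hq).symm
      · rw [if_neg h2, mul_zero]
    · rw [if_neg h1, zero_mul]
  · simp

theorem commute_of_actsOnlyOn {S S' : Finset (Fin n)} (hS : Disjoint S S') {T T' : QubitOperator n}
    (hT : T.ActsOnlyOn S) (hT' : T'.ActsOnlyOn S') : Commute T T' := by
  obtain ⟨M, hM⟩ := hT
  obtain ⟨M', hM'⟩ := hT'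
  ext x y
  rw [mul_apply_of_actsOnlyOn hS hM hM', mul_apply_of_actsOnlyOn hS.symm hM' hM, mul_comm]
  refine if_congr ?_ rfl rfl
  exact forall_congr' fun q => forall_comm

/-- `T` commutes with all operators that act only on qubits outside `S`. -/
def LocalOn (S : Finset (Fin n)) (T : QubitOperator n) : Prop :=
  ∀ S' : Finset (Fin n), Disjoint S S' → ∀ B : QubitOperator n, B.ActsOnlyOn S' → Commute T B

theorem localOn_of_actsOnlyOn {S : Finset (Fin n)} {T : QubitOperator n} (h : T.ActsOnlyOn S) :
    LocalOn S T := fun _ hS _ hB => commute_of_actsOnlyOn hS h hB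

theorem LocalOn.smul {S : Finset (Fin n)} {T : QubitOperator n} (h : LocalOn S T) (c : ℂ) :
    LocalOn S (c • T) := fun S' hS B hB => (h S' hS B hB).smul_left c

theorem LocalOn.mono {S S' : Finset (Fin n)} {T : QubitOperator n} (h : LocalOn S T)
    (hS : S ⊆ S') : LocalOn S' T := fun R hR => h R (hR.mono_left hS)

/-- Locality in terms of commutation passes formally to products and differences; no matrix on the
union of the supports has to be built. -/
theorem LocalOn.comm {S S' : Finset (Fin n)} {T T' : QubitOperator n} (h : LocalOn S T)
    (h' : LocalOn S' T') : LocalOn (S' ∪ S) (comm T T') := by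
  intro R hR B hB
  have h1 := h.mono Finset.subset_union_right R hR B hB
  have h2 := h'.mono Finset.subset_union_left R hR B hB
  exact (h1.mul_left h2).sub_left (h2.mul_left h1)

end Locality

/-! ### Commutator bounds for clustered Hamiltonians -/

section Clustered

variable {n L : ℕ}

open ClusteredHamiltonian

/-- The sum of the values of a seminorm at the commutators with all terms of the Hamiltonian. -/
def termSum (H : ClusteredHamiltonian n L) (f : Seminorm ℝ (QubitOperator n))
    (c : QubitOperator n) : ℝ :=
  ∑ k, f (comm ((-Complex.I) • H.intra k) c) + ∑ l, f (comm ((-Complex.I) • H.inter l) c)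

theorem summands_last (H : ClusteredHamiltonian n L) :
    H.summands (Fin.last L) = (-Complex.I) • H.A := by
  simp [summands]

theorem summands_castSucc (H : ClusteredHamiltonian n L) (l : Fin L) :
    H.summands l.castSucc = (-Complex.I) • H.inter l := by
  simp [summands]

/-- The formula exponentiates `A` as a whole; only the estimates split it into local terms, so `‖A‖`
never enters. -/
theorem seminorm_comm_A_le (H : ClusteredHamiltonian n L) (f : Seminorm ℝ (QubitOperator n))
    (c : QubitOperator n) :
    f (comm ((-Complex.I) • H.A) c) ≤ ∑ k, f (comm ((-Complex.I) • H.intra k) c) := by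
  have h : comm ((-Complex.I) • H.A) c = ∑ k, comm ((-Complex.I) • H.intra k) c := by
    simp only [comm_apply, ClusteredHamiltonian.A, Finset.smul_sum, Finset.sum_mul, Finset.mul_sum,
      Finset.sum_sub_distrib]
  rw [h]
  exact Finset.le_sum_of_subadditive f (map_zero f).le (map_add_le_add f) _ _

theorem sum_summands_le_termSum (H : ClusteredHamiltonian n L) (f : Seminorm ℝ (QubitOperator n))
    (c : QubitOperator n) : ∑ γ, f (comm (H.summands γ) c) ≤ termSum H f c := by
  rw [Fin.sum_univ_castSucc, summands_last, termSum, add_comm]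
  simp only [summands_castSucc]
  gcongr
  exact seminorm_comm_A_le H f c

variable {Υ Γ : ℕ}

/-- Sums over the factors of a product formula are bounded by sums over the summands. -/
theorem sum_factors_le {N : Type} [Fintype N] [DecidableEq N] (F : ProductFormula Υ Γ)
    (X : Fin Γ → Matrix N N ℂ) {g : Matrix N N ℂ → ℝ} (hg : ∀ x, 0 ≤ g x)
    (hsmul : ∀ (a : ℝ) x, g (a • x) = |a| * g x) :
    ((factors F X).map g).sum ≤ Υ * ∑ γ, g (X γ) := by
  rw [factors_eq_map, List.map_map, sum_map_flatMap_finRange]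
  calc _ ≤ ∑ _υ : Fin Υ, ∑ γ, g (X γ) := by
        refine Finset.sum_le_sum fun υ _ => ?_
        rw [← Equiv.sum_comp (F.perm υ) fun γ => g (X γ)]
        refine Finset.sum_le_sum fun γ _ => ?_
        rw [Function.comp_apply, hsmul]
        exact mul_le_of_le_one_left (hg _) (F.coeff_le υ γ)
    _ = _ := by simp

theorem commSeminorm_factors_le (H : ClusteredHamiltonian n L) (F : ProductFormula Υ (L + 1))
    (f : Seminorm ℝ (QubitOperator n)) (c : QubitOperator n) :
    commSeminorm (factors F H.summands) f c ≤ Υ * ∑ γ, f (comm (H.summands γ) c) := by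
  rw [commSeminorm_apply]
  refine sum_factors_le F H.summands (g := fun y => f (comm y c)) (fun _ => apply_nonneg _ _)
    fun a x => ?_
  have h : comm (a • x) c = a • comm x c := by simp [smul_sub]
  rw [h, map_smul_eq_mul, Real.norm_eq_abs]

theorem commBound_factors_le (H : ClusteredHamiltonian n L) (F : ProductFormula Υ (L + 1)) (p : ℕ) :
    commBound (factors F H.summands) p nrm ≤
      Υ * ∑ γ, (commSeminorm (factors F H.summands))^[p] nrm (H.summands γ) :=
  sum_factors_le F H.summands (fun _ => apply_nonneg _ _)
    fun a x => by rw [map_smul_eq_mul, Real.norm_eq_abs]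

theorem norm_comm_le {𝔸 : Type*} [NormedRing 𝔸] [NormedAlgebra ℝ 𝔸] (x c : 𝔸) (hx : ‖x‖ ≤ 1) :
    ‖comm x c‖ ≤ 2 * ‖c‖ := by
  have h1 : ‖x * c‖ ≤ 1 * ‖c‖ := (norm_mul_le _ _).trans (by gcongr)
  have h2 : ‖c * x‖ ≤ ‖c‖ * 1 := (norm_mul_le _ _).trans (by gcongr)
  rw [comm_apply]
  linarith [norm_sub_le (x * c) (c * x)]

theorem card_filter_not_disjoint_le {ι : Type*} [Fintype ι] (supp : ι → Finset (Fin n))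
    (S : Finset (Fin n)) :
    (Finset.univ.filter fun i => ¬ Disjoint (supp i) S).card ≤
      ∑ u ∈ S, (Finset.univ.filter fun i => u ∈ supp i).card := by
  classical
  refine (Finset.card_le_card fun i hi => ?_).trans Finset.card_biUnion_le
  obtain ⟨u, h1, h2⟩ := Finset.not_disjoint_iff.1 (Finset.mem_filter.1 hi).2
  exact Finset.mem_biUnion.2 ⟨u, h2, by simpa using h1⟩

/-- Terms with support disjoint from `S` commute with `c`. Any other shares a qubit with `S`, so it
enlarges the support by at most one qubit and the norm by at most a factor 2. -/
theorem sum_comm_terms_le {ι : Type*} [Fintype ι] (supp : ι → Finset (Fin n))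
    (T : ι → QubitOperator n) (hT : ∀ i, (T i).ActsOnlyOn (supp i)) (hT1 : ∀ i, ‖T i‖ ≤ 1)
    (hcard : ∀ i, (supp i).card ≤ 2) {f : Seminorm ℝ (QubitOperator n)} {s : ℕ} {B : ℝ}
    (hB : 0 ≤ B) (hf : ∀ (S : Finset (Fin n)) (c : QubitOperator n), S.card ≤ s + 1 →
      LocalOn S c → f c ≤ B * ‖c‖)
    {S : Finset (Fin n)} (hS : S.card ≤ s) {c : QubitOperator n} (hc : LocalOn S c) :
    ∑ i, f (comm ((-Complex.I) • T i) c) ≤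
      (∑ u ∈ S, (Finset.univ.filter fun i => u ∈ supp i).card : ℕ) * (2 * B * ‖c‖) := by
  classical
  have h1 : ∀ i, f (comm ((-Complex.I) • T i) c) ≤
      if ¬ Disjoint (supp i) S then 2 * B * ‖c‖ else 0 := by
    intro i
    by_cases hi : Disjoint (supp i) S
    · have h0 : comm ((-Complex.I) • T i) c = 0 :=
        sub_eq_zero.2 (((hc (supp i) hi.symm (T i) (hT i)).smul_right _).eq).symm
      rw [h0, map_zero, if_neg (not_not.2 hi)]
    · rw [if_pos hi]
      have hloc := ((localOn_of_actsOnlyOn (hT i)).smul (-Complex.I)).comm hc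
      have hpos : 0 < (S ∩ supp i).card := by
        rw [Finset.card_pos]
        exact Finset.not_disjoint_iff_nonempty_inter.1 fun h => hi h.symm
      have hle := Finset.card_union_add_card_inter S (supp i)
      have hi2 := hcard i
      refine (hf _ _ (by omega) hloc).trans ?_
      have hn : ‖(-Complex.I) • T i‖ ≤ 1 := by
        rw [norm_smul]
        simpa using hT1 i
      calc _ ≤ B * (2 * ‖c‖) := mul_le_mul_of_nonneg_left (norm_comm_le _ _ hn) hB
        _ = _ := by ring
  calc _ ≤ ∑ i, if ¬ Disjoint (supp i) S then 2 * B * ‖c‖ else 0 :=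
        Finset.sum_le_sum fun i _ => h1 i
    _ = ((Finset.univ.filter fun i => ¬ Disjoint (supp i) S).card : ℝ) * (2 * B * ‖c‖) := by
      rw [← Finset.sum_filter, Finset.sum_const, nsmul_eq_mul]
    _ ≤ _ := by
      gcongr
      exact card_filter_not_disjoint_le supp S

theorem interSupp_card_le (H : ClusteredHamiltonian n L) (l : Fin L) :
    (H.interSupp l).card ≤ 2 := by
  obtain ⟨u, v, h, -⟩ := H.inter_party l
  rw [h]
  exact Finset.card_le_two

theorem termSum_le {H : ClusteredHamiltonian n L} {D : ℕ} (hD : ∀ u, H.numTerms u ≤ D)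
    {f : Seminorm ℝ (QubitOperator n)} {s : ℕ} {B : ℝ}
    (hB : 0 ≤ B) (hf : ∀ (S : Finset (Fin n)) (c : QubitOperator n), S.card ≤ s + 1 →
      LocalOn S c → f c ≤ B * ‖c‖)
    {S : Finset (Fin n)} (hS : S.card ≤ s) {c : QubitOperator n} (hc : LocalOn S c) :
    termSum H f c ≤ 2 * D * s * B * ‖c‖ := by
  have h1 := sum_comm_terms_le H.intraSupp H.intra H.intra_acts H.intra_norm_le H.intra_card_le
    hB hf hS hc
  have h2 := sum_comm_terms_le H.interSupp H.inter H.inter_acts H.inter_norm_le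
    (interSupp_card_le H) hB hf hS hc
  refine (add_le_add h1 h2).trans ?_
  rw [← add_mul, ← Nat.cast_add, ← Finset.sum_add_distrib]
  have h3 : ∑ u ∈ S, H.numTerms u ≤ s * D :=
    (Finset.sum_le_card_nsmul S _ D fun u _ => hD u).trans (Nat.mul_le_mul_right D hS)
  calc _ ≤ ((s * D : ℕ) : ℝ) * (2 * B * ‖c‖) := by
        gcongr
        exact h3
    _ = _ := by
        push_cast
        ring

/-- The bound on `k`-fold commutators with an operator on `s` qubits. -/
def growth (Υ D k s : ℕ) : ℝ := (2 * Υ * D) ^ k * s.ascFactorial k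

theorem growth_nonneg (Υ D k s : ℕ) : 0 ≤ growth Υ D k s := by
  unfold growth
  positivity

theorem growth_succ (Υ D k s : ℕ) :
    growth Υ D (k + 1) s = Υ * (2 * D * s * growth Υ D k (s + 1)) := by
  have h : (s.ascFactorial (k + 1) : ℝ) = s * (s + 1).ascFactorial k := by
    rw [Nat.ascFactorial_succ, ← Nat.succ_ascFactorial]
    push_cast
    rfl
  rw [growth, growth, h]
  ring

theorem iterate_commSeminorm_le {H : ClusteredHamiltonian n L} {D : ℕ}
    (hD : ∀ u, H.numTerms u ≤ D) (F : ProductFormula Υ (L + 1)) (k s : ℕ) {S : Finset (Fin n)}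
    (hS : S.card ≤ s) {c : QubitOperator n} (hc : LocalOn S c) :
    (commSeminorm (factors F H.summands))^[k] nrm c ≤ growth Υ D k s * ‖c‖ := by
  induction k generalizing s S c with
  | zero => simp [growth]
  | succ k ih =>
    rw [Function.iterate_succ_apply', growth_succ, mul_assoc]
    refine (commSeminorm_factors_le H F _ c).trans ?_
    gcongr
    refine (sum_summands_le_termSum H _ c).trans ?_
    exact termSum_le hD (growth_nonneg _ _ _ _) (fun S c hS hc => ih (s + 1) hS hc) hS hc

theorem norm_neg_I_smul (T : QubitOperator n) : ‖(-Complex.I) • T‖ = ‖T‖ := by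
  rw [norm_smul]
  simp

/-- Commutators of a clustered Hamiltonian are bounded by the interaction strength. -/
theorem commBound_le_strength {H : ClusteredHamiltonian n L} {D : ℕ}
    (hD : ∀ u, H.numTerms u ≤ D) (F : ProductFormula Υ (L + 1)) {p : ℕ} (hp : 1 ≤ p) :
    commBound (factors F H.summands) p nrm ≤ Υ * (2 * growth Υ D p 2 * H.strength) := by
  obtain ⟨q, rfl⟩ : ∃ q, p = q + 1 := ⟨p - 1, by omega⟩
  refine (commBound_factors_le H F _).trans ?_
  gcongr
  have hloc : ∀ l, LocalOn (H.interSupp l) ((-Complex.I) • H.inter l) := fun l =>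
    (localOn_of_actsOnlyOn (H.inter_acts l)).smul _
  -- One copy of the bound is for the innermost `H_l`, the other for the innermost `A`.
  rw [Fin.sum_univ_castSucc, two_mul, add_mul, strength, Finset.mul_sum]
  simp only [summands_castSucc, summands_last]
  refine add_le_add (Finset.sum_le_sum fun l _ => ?_) ?_
  · rw [← norm_neg_I_smul (H.inter l)]
    exact iterate_commSeminorm_le hD F _ 2 (interSupp_card_le H l) (hloc l)
  · rw [Function.iterate_succ_apply']
    set f := (commSeminorm (factors F H.summands))^[q] nrm with hf
    refine (commSeminorm_factors_le H F _ _).trans ?_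
    -- `[A, A] = 0` removes the only contribution not controlled by `h_B`; this takes at least one
    -- commutator, hence `1 ≤ p`.
    rw [Fin.sum_univ_castSucc, summands_last, comm_apply ((-Complex.I) • H.A) _, sub_self, map_zero,
      add_zero, Finset.mul_sum]
    refine Finset.sum_le_sum fun l _ => ?_
    have hanti : f (comm (H.summands l.castSucc) ((-Complex.I) • H.A)) =
        f (comm ((-Complex.I) • H.A) ((-Complex.I) • H.inter l)) := by
      rw [summands_castSucc, ← map_neg_eq_map f]
      congr 1
      simp only [comm_apply, neg_sub]
    -- After the swap `H_l` is innermost, and only terms of `A` that touch its two qubits survive.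
    rw [hanti, growth_succ, mul_assoc, ← norm_neg_I_smul (H.inter l)]
    gcongr
    refine (seminorm_comm_A_le H f _).trans (le_trans ?_ (termSum_le hD (growth_nonneg _ _ _ _)
      (fun S c hS hc => iterate_commSeminorm_le hD F q (2 + 1) hS hc)
      (interSupp_card_le H l) (hloc l)))
    exact le_add_of_nonneg_right (Finset.sum_nonneg fun _ _ => apply_nonneg _ _)

end Clustered

end TrotterError

namespace TrotterError

open NormedSpace Filter Topology Asymptotics ClusteredHamiltonian

/-! ### Trotter error and Trotter number -/

theorem isContractive_of_isHermitian {N : Type} [Fintype N] [DecidableEq N] [Nonempty N]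
    {T : Matrix N N ℂ} (hT : T.IsHermitian) : IsContractive ((-Complex.I) • T) := by
  intro t
  let _ : NormedAlgebra ℚ (Matrix N N ℂ) := .restrictScalars ℚ ℝ (Matrix N N ℂ)
  refine (CStarRing.norm_of_mem_unitary (exp_mem_unitary_of_mem_skewAdjoint ?_)).le
  rw [skewAdjoint.mem_iff, star_smul, star_smul, Matrix.star_eq_conjTranspose, hT.eq]
  simp

theorem norm_pow_sub_pow_le {𝔸 : Type*} [NormedRing 𝔸] [NormOneClass 𝔸] {a b : 𝔸} (ha : ‖a‖ ≤ 1)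
    (hb : ‖b‖ ≤ 1) (s : ℕ) : ‖a ^ s - b ^ s‖ ≤ s * ‖a - b‖ := by
  induction s with
  | zero => simp
  | succ s ih =>
    have h1 : ‖a ^ s‖ ≤ 1 := (norm_pow_le a s).trans (pow_le_one₀ (norm_nonneg _) ha)
    calc ‖a ^ (s + 1) - b ^ (s + 1)‖ = ‖a ^ s * (a - b) + (a ^ s - b ^ s) * b‖ := by
          rw [pow_succ, pow_succ]
          congr 1
          noncomm_ring
      _ ≤ 1 * ‖a - b‖ + (s * ‖a - b‖) * 1 := by
          refine (norm_add_le _ _).trans (add_le_add ?_ ?_)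
          · exact (norm_mul_le _ _).trans (by gcongr)
          · exact (norm_mul_le _ _).trans (by gcongr)
      _ = _ := by
          push_cast
          ring

variable {n L Υ : ℕ} (H : ClusteredHamiltonian n L) (F : ProductFormula Υ (L + 1))

theorem isHermitian_A : H.A.IsHermitian := by
  simp only [ClusteredHamiltonian.A, Matrix.IsHermitian, Matrix.conjTranspose_sum,
    fun k => (H.intra_hermitian k).eq]

theorem isHermitian_total : H.total.IsHermitian := by
  refine (isHermitian_A H).add ?_
  simp only [Matrix.IsHermitian, Matrix.conjTranspose_sum, fun l => (H.inter_hermitian l).eq]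

theorem sum_summands : ∑ γ, H.summands γ = (-Complex.I) • H.total := by
  rw [Fin.sum_univ_castSucc, summands_last, total, smul_add, Finset.smul_sum, add_comm]
  simp only [summands_castSucc]

theorem evolution_eq_exp (t : ℝ) : H.evolution t = exp (t • ∑ γ, H.summands γ) := by
  rw [evolution, sum_summands, mul_comm, mul_smul]
  rfl

theorem isContractive_summands (γ : Fin (L + 1)) : IsContractive (H.summands γ) := by
  refine Fin.lastCases ?_ (fun l => ?_) γ
  · rw [summands_last]
    exact isContractive_of_isHermitian (isHermitian_A H)
  · rw [summands_castSucc]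
    exact isContractive_of_isHermitian (H.inter_hermitian l)

theorem isContractive_sum_summands : IsContractive (∑ γ, H.summands γ) := by
  rw [sum_summands]
  exact isContractive_of_isHermitian (isHermitian_total H)

theorem isContractive_factors : ∀ y ∈ factors F H.summands, IsContractive y := by
  intro y hy
  rw [factors_eq_map, List.mem_map] at hy
  obtain ⟨i, -, rfl⟩ := hy
  exact (isContractive_summands H _).smul _

theorem strength_nonneg : 0 ≤ H.strength := Finset.sum_nonneg fun _ _ => norm_nonneg _

/-- The prefactor of the Trotter error. -/
def errorConst (p Υ m : ℕ) : ℝ := Υ * (2 * ((2 * Υ * m) ^ p * (2 : ℕ).ascFactorial p))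

theorem errorConst_nonneg (p Υ m : ℕ) : 0 ≤ errorConst p Υ m := by
  unfold errorConst
  positivity

variable {H F}

theorem norm_eval_sub_evolution_le {d m p : ℕ} (hd : H.DegreeLE d m) (hp : 1 ≤ p)
    (hF : F.HasOrder H.summands p) {t : ℝ} (ht : 0 ≤ t) :
    ‖F.eval H.summands t - H.evolution t‖ ≤
      errorConst p Υ m * ((d : ℝ) + 1) ^ p * H.strength * t ^ (p + 1) := by
  rw [eval_eq_expProd, evolution_eq_exp]
  refine (norm_expProd_sub_exp_le_commBound (isContractive_factors H F)
    (isContractive_sum_summands H) hp ((hasOrder_iff F H.summands p).1 hF) ht).trans ?_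
  gcongr
  refine (commBound_le_strength (fun u => (hd u).2) F hp).trans_eq ?_
  rw [growth, errorConst]
  push_cast
  rw [show (2 * Υ * (m * (d + 1)) : ℝ) = 2 * Υ * m * (d + 1) by ring, mul_pow _ ((d : ℝ) + 1)]
  ring

theorem sum_norm_factor_sub_le {Γ : ℕ} {N : Type} [Fintype N] [DecidableEq N]
    (F : ProductFormula Υ Γ) (X : Fin Γ → Matrix N N ℂ) (b : Fin Γ → ℝ) (x : Matrix N N ℂ) :
    (((List.finRange Υ).flatMap fun υ => (List.finRange Γ).map fun γ => (υ, γ)).map fun i =>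
      ‖F.coeff i.1 i.2 • X (F.perm i.1 i.2) - (F.coeff i.1 i.2 * b (F.perm i.1 i.2)) • x‖).sum ≤
      Υ * ∑ γ, ‖X γ - b γ • x‖ := by
  rw [sum_map_flatMap_finRange]
  calc _ ≤ ∑ _υ : Fin Υ, ∑ γ, ‖X γ - b γ • x‖ := by
        refine Finset.sum_le_sum fun υ _ => ?_
        rw [← Equiv.sum_comp (F.perm υ) fun γ => ‖X γ - b γ • x‖]
        refine Finset.sum_le_sum fun γ _ => ?_
        rw [mul_smul, ← smul_sub, norm_smul]
        exact mul_le_of_le_one_left (norm_nonneg _) (F.coeff_le υ γ)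
    _ = _ := by simp

/-- Coefficient 1 for `A` and 0 for every `H_l`: up to terms of total norm `h_B`, all summands are
multiples of `-iA`. -/
theorem exists_sum_norm_summands_sub (H : ClusteredHamiltonian n L) :
    ∃ b : Fin (L + 1) → ℝ, ∑ γ, ‖H.summands γ - b γ • ((-Complex.I) • H.A)‖ = H.strength := by
  refine ⟨Fin.lastCases 1 fun _ => 0, ?_⟩
  rw [Fin.sum_univ_castSucc]
  simp only [Fin.lastCases_last, Fin.lastCases_castSucc, summands_last, summands_castSucc, one_smul,
    zero_smul, sub_self, sub_zero, norm_zero, add_zero, norm_neg_I_smul, strength]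

/-- Of the order condition only the consistency of the coefficients is used. The bound is linear in
`t` and independent of the degree. -/
theorem norm_eval_sub_evolution_le_strength {p : ℕ} (hp : 1 ≤ p) (hF : F.HasOrder H.summands p)
    {t : ℝ} (ht : 0 ≤ t) :
    ‖F.eval H.summands t - H.evolution t‖ ≤ 2 * Υ * H.strength * t := by
  have hsum := sum_eq_of_isBigO (isContractive_factors H F) hp
    ((hasOrder_iff F H.summands p).1 hF)
  have hc := isContractive_sum_summands H
  rw [eval_eq_expProd, evolution_eq_exp, ← hsum]
  rw [← hsum] at hc
  rw [factors_eq_map] at hc ⊢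
  obtain ⟨b, hb⟩ := exists_sum_norm_summands_sub H
  refine (norm_expProd_sub_exp_sum_le _ (fun i => (isContractive_summands H _).smul _) hc
    (fun i => F.coeff i.1 i.2 * b (F.perm i.1 i.2))
    (isContractive_of_isHermitian (isHermitian_A H)) ht).trans ?_
  have h := sum_norm_factor_sub_le F H.summands b ((-Complex.I) • H.A)
  rw [hb] at h
  rw [mul_assoc 2 (Υ : ℝ)]
  exact mul_le_mul_of_nonneg_right (mul_le_mul_of_nonneg_left h zero_le_two) ht

theorem trotterError_le {s : ℕ} (hs : 1 ≤ s) (t : ℝ) :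
    H.trotterError F t s ≤
      s * ‖F.eval H.summands (t / s) - H.evolution (t / s)‖ := by
  have hs0 : (s : ℝ) ≠ 0 := by positivity
  have h1 : H.evolution t = H.evolution (t / s) ^ s := by
    let _ : NormedAlgebra ℚ (QubitOperator n) := .restrictScalars ℚ ℝ (QubitOperator n)
    rw [evolution_eq_exp, evolution_eq_exp, ← exp_nsmul, ← Nat.cast_smul_eq_nsmul ℝ, smul_smul,
      mul_div_cancel₀ _ hs0]
  rw [trotterError, h1]
  refine norm_pow_sub_pow_le ?_ ?_ s
  · rw [eval_eq_expProd]
    exact norm_expProd_le (isContractive_factors H F) _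
  · rw [evolution_eq_exp]
    exact isContractive_sum_summands H _

/-- The Trotter number for an error of order `p + 1`. -/
theorem exists_trotterNumber {p : ℕ} (hp : 1 ≤ p) {M : ℝ} (hM : 0 ≤ M)
    (h : ∀ t : ℝ, 0 ≤ t → ‖F.eval H.summands t - H.evolution t‖ ≤ M * t ^ (p + 1))
    {t ε : ℝ} (ht : 0 ≤ t) (hε : 0 < ε) :
    ∃ r : ℕ, H.TrotterNumberSuffices F t ε r ∧
      (r : ℝ) ≤ max 1 (2 * (M * t ^ (p + 1) / ε) ^ (1 / (p : ℝ))) := by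
  set ρ := (M * t ^ (p + 1) / ε) ^ (1 / (p : ℝ)) with hρ
  have hbase : 0 ≤ M * t ^ (p + 1) / ε := by positivity
  have hρ0 : 0 ≤ ρ := by positivity
  have hρp : ρ ^ p = M * t ^ (p + 1) / ε := by
    rw [hρ, one_div]
    exact Real.rpow_inv_natCast_pow hbase (by omega)
  refine ⟨max 1 ⌈ρ⌉₊, ⟨le_max_left _ _, fun s hs => ?_⟩, ?_⟩
  · have hs1 : 1 ≤ s := (le_max_left _ _).trans hs
    have hs0 : (0 : ℝ) < s := by positivity
    have hρs : ρ ≤ s := (Nat.le_ceil ρ).trans (by exact_mod_cast (le_max_right _ _).trans hs)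
    have hpow : M * t ^ (p + 1) / ε ≤ (s : ℝ) ^ p := hρp ▸ pow_le_pow_left₀ hρ0 hρs p
    calc _ ≤ s * ‖F.eval H.summands (t / s) - H.evolution (t / s)‖ := trotterError_le hs1 t
      _ ≤ s * (M * (t / s) ^ (p + 1)) := by
        gcongr
        exact h _ (by positivity)
      _ = M * t ^ (p + 1) / s ^ p := by
        rw [div_pow, pow_succ (s : ℝ)]
        field_simp
      _ ≤ ε := by
        rw [div_le_iff₀ hε] at hpow
        rw [div_le_iff₀ (by positivity), mul_comm ε]
        exact hpow
  · rw [Nat.cast_max, Nat.cast_one]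
    refine max_le (le_max_left _ _) ?_
    -- For `ρ ≥ 1` rounding up costs at most a factor 2, as `⌈ρ⌉ ≤ ρ + 1 ≤ 2ρ`.
    rcases le_total ρ 1 with hle | hle
    · refine le_max_of_le_left ?_
      exact_mod_cast Nat.ceil_le.2 (by exact_mod_cast hle)
    · refine le_max_of_le_right ?_
      linarith [Nat.ceil_lt_add_one hρ0]

/-- An inter-party term would join two distinct qubits. This handles `d = 0`, where `d + 1` is not
bounded by a multiple of `d`. -/
theorem strength_eq_zero {m : ℕ} (h : H.DegreeLE 0 m) : H.strength = 0 := by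
  refine Finset.sum_eq_zero fun l _ => ?_
  obtain ⟨u, v, hl, huv⟩ := H.inter_party l
  have hv : v ∈ H.neighbors u := by
    refine Finset.mem_filter.2 ⟨Finset.mem_univ _, fun hvu => huv (by rw [hvu]), Or.inr ⟨l, ?_⟩⟩
    simp [hl]
  have hcard := (h u).1
  rw [Nat.le_zero, Finset.card_eq_zero] at hcard
  simp [hcard] at hv

theorem add_one_mul_le {d m : ℕ} (h : H.DegreeLE d m) {x : ℝ} (hx : 0 ≤ x)
    (h0 : H.strength = 0 → x = 0) : ((d : ℝ) + 1) * x ≤ 2 * d * x := by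
  rcases Nat.eq_zero_or_pos d with rfl | hd
  · simp [h0 (strength_eq_zero h)]
  · have : (1 : ℝ) ≤ d := by exact_mod_cast hd
    gcongr
    linarith

theorem add_one_pow_mul_strength_le {d m : ℕ} (h : H.DegreeLE d m) {p : ℕ} (hp : 1 ≤ p) :
    ((d : ℝ) + 1) ^ p * H.strength ≤ 2 ^ p * (d : ℝ) ^ (p * (p + 1) / 2) * H.strength := by
  rcases Nat.eq_zero_or_pos d with rfl | hd
  · simp [strength_eq_zero h]
  · have h1 : (1 : ℝ) ≤ d := by exact_mod_cast hd
    have hpp : p ≤ p * (p + 1) / 2 := by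
      rw [Nat.le_div_iff_mul_le two_pos]
      exact Nat.mul_le_mul_left p (by omega)
    have := strength_nonneg H
    gcongr
    calc ((d : ℝ) + 1) ^ p ≤ (2 * d) ^ p := by
          gcongr
          linarith
      _ = 2 ^ p * (d : ℝ) ^ p := mul_pow _ _ _
      _ ≤ _ := by
        gcongr

theorem natCast_le_rpow {d p : ℕ} (hp : 1 ≤ p) : (d : ℝ) ≤ (d : ℝ) ^ ((1 + (p : ℝ)) / 2) := by
  have hp1 : (1 : ℝ) ≤ p := by exact_mod_cast hp
  rcases Nat.eq_zero_or_pos d with rfl | hd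
  · rw [Nat.cast_zero]
    positivity
  · exact Real.self_le_rpow_of_one_le (by exact_mod_cast hd) (by linarith)

theorem rpow_trotter {M t ε : ℝ} (hM : 0 ≤ M) (ht : 0 ≤ t) (hε : 0 < ε) {p : ℕ} (hp : 1 ≤ p) :
    (M * t ^ (p + 1) / ε) ^ (1 / (p : ℝ)) =
      M ^ (1 / (p : ℝ)) * t ^ (1 + 1 / (p : ℝ)) / ε ^ (1 / (p : ℝ)) := by
  have hp0 : (p : ℝ) ≠ 0 := by positivity
  rw [Real.div_rpow (by positivity) hε.le, Real.mul_rpow hM (by positivity), ← Real.rpow_natCast,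
    ← Real.rpow_mul ht]
  congr 3
  push_cast
  field_simp

theorem trotterNumberSuffices_one {p : ℕ} (hp : 1 ≤ p) (hF : F.HasOrder H.summands p) {t ε : ℝ}
    (ht : 0 ≤ t) (h : 2 * Υ * H.strength * t ≤ ε) : H.TrotterNumberSuffices F t ε 1 := by
  refine ⟨le_rfl, fun s hs => (trotterError_le hs t).trans (le_trans ?_ h)⟩
  have hs0 : (0 : ℝ) < s := by positivity
  calc _ ≤ s * (2 * Υ * H.strength * (t / s)) := by
        gcongr
        exact norm_eval_sub_evolution_le_strength hp hF (by positivity)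
    _ = _ := by field_simp

/-- With `y = h t / ε` both sides are `t` times a power of `y`, up to the constant. Since `a y > 1`,
the factor `(a y) ^ (δ - q) ≥ 1` can be inserted. -/
theorem rpow_le_of_lt {h t ε a δ q : ℝ} (hh : 0 ≤ h) (ht : 0 ≤ t) (hε : 0 < ε) (ha : 0 ≤ a)
    (hqδ : q ≤ δ) (hlt : ε < a * h * t) :
    h ^ q * t ^ (1 + q) / ε ^ q ≤ a ^ (δ - q) * (h ^ δ * t ^ (1 + δ) / ε ^ δ) := by
  have hpos : 0 < a * h * t := hε.trans hlt
  have ht0 : 0 < t := ht.lt_of_ne fun h0 => by simp [← h0] at hpos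
  have hh0 : 0 < h := hh.lt_of_ne fun h0 => by simp [← h0] at hpos
  have hy : 0 < h * t / ε := by positivity
  have key : ∀ r : ℝ, h ^ r * t ^ (1 + r) / ε ^ r = t * (h * t / ε) ^ r := fun r => by
    rw [Real.div_rpow (by positivity) hε.le, Real.mul_rpow hh ht, Real.rpow_add ht0, Real.rpow_one]
    ring
  rw [key, key]
  have h1 : (1 : ℝ) ≤ (a * (h * t / ε)) ^ (δ - q) := by
    refine Real.one_le_rpow ?_ (by linarith)
    rw [← mul_div_assoc, one_le_div hε]
    linarith
  calc t * (h * t / ε) ^ q = t * (h * t / ε) ^ q * 1 := (mul_one _).symm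
    _ ≤ t * (h * t / ε) ^ q * (a * (h * t / ε)) ^ (δ - q) := by gcongr
    _ = a ^ (δ - q) * (t * ((h * t / ε) ^ q * (h * t / ε) ^ (δ - q))) := by
      rw [Real.mul_rpow ha hy.le]
      ring
    _ = _ := by
      rw [← Real.rpow_add hy, add_sub_cancel]

/-- The Trotter number for an arbitrary degree. -/
theorem exists_trotterNumber_of_degreeLE {d m p : ℕ} (hd : H.DegreeLE d m) (hp : 1 ≤ p)
    (hF : F.HasOrder H.summands p) {t ε : ℝ} (ht : 0 ≤ t) (hε : 0 < ε) :
    ∃ r : ℕ, H.TrotterNumberSuffices F t ε r ∧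
      (r : ℝ) ≤ max 1 (2 * errorConst p Υ m ^ (1 / (p : ℝ)) * ((d : ℝ) + 1) *
        (H.strength ^ (1 / (p : ℝ)) * t ^ (1 + 1 / (p : ℝ)) / ε ^ (1 / (p : ℝ)))) := by
  have hK := errorConst_nonneg p Υ m
  have hh := strength_nonneg H
  obtain ⟨r, h1, h2⟩ := exists_trotterNumber hp
    (M := errorConst p Υ m * ((d : ℝ) + 1) ^ p * H.strength) (by positivity)
    (fun t ht => norm_eval_sub_evolution_le hd hp hF ht) ht hε
  refine ⟨r, h1, h2.trans_eq ?_⟩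
  rw [rpow_trotter (by positivity) ht hε hp, Real.mul_rpow (by positivity) hh,
    Real.mul_rpow hK (by positivity), one_div, Real.pow_rpow_inv_natCast (by positivity) (by omega)]
  congr 1
  ring

end TrotterError

end

theorem theoremG1 :
    -- Trotter error and Trotter number of an arbitrary formula of order `p`; the constant depends
    -- on the order, the number of stages and the multiplicity of the terms only
    (∀ p Υ m : ℕ, 1 ≤ p → ∃ C : ℝ, ∀ (d n L : ℕ) (H : ClusteredHamiltonian n L)
      (F : ProductFormula Υ (L + 1)), H.DegreeLE d m → F.HasOrder H.summands p →
      (∀ t : ℝ, 0 ≤ t →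
        ‖F.eval H.summands t - H.evolution t‖ ≤
          C * (d : ℝ) ^ (p * (p + 1) / 2) * H.strength * t ^ (p + 1)) ∧
      (∀ t ε : ℝ, 0 ≤ t → 0 < ε → ∃ r : ℕ, H.TrotterNumberSuffices F t ε r ∧
        (r : ℝ) ≤ max 1 (C * (d : ℝ) ^ ((1 + (p : ℝ)) / 2) *
          (H.strength ^ (1 / (p : ℝ)) * t ^ (1 + 1 / (p : ℝ)) / ε ^ (1 / (p : ℝ)))))) ∧
    -- for sufficiently large `p`, formulas of order `p` with a fixed number of stages exist, and
    -- all of them have a Trotter number that scales with exponents arbitrarily close to 0, 1, 0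
    (∀ δ : ℝ, 0 < δ → ∃ p₀ : ℕ, ∀ p : ℕ, p₀ ≤ p →
      (∃ Υ : ℕ, ∀ L : ℕ, ∃ F : ProductFormula Υ (L + 1),
        ∀ (n : ℕ) (H : ClusteredHamiltonian n L), F.HasOrder H.summands p) ∧
      (∀ Υ m d : ℕ, ∃ C : ℝ, ∀ (n L : ℕ) (H : ClusteredHamiltonian n L)
        (F : ProductFormula Υ (L + 1)), H.DegreeLE d m → F.HasOrder H.summands p →
        ∀ t ε : ℝ, 0 ≤ t → 0 < ε → ∃ r : ℕ, H.TrotterNumberSuffices F t ε r ∧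
          (r : ℝ) ≤ max 1 (C * (H.strength ^ δ * t ^ (1 + δ) / ε ^ δ)))) := by
  open TrotterError in
  refine ⟨fun p Υ m hp => ?_, fun δ hδ => ⟨max 1 ⌈1 / δ⌉₊, fun p hp => ⟨?_, fun Υ m d => ?_⟩⟩⟩
  · have hK := errorConst_nonneg p Υ m
    set K := errorConst p Υ m
    -- One summand for each claim: `2 ^ p` is from `d + 1 ≤ 2d`, and 4 combines this with the factor
    -- 2 of rounding.
    refine ⟨K * 2 ^ p + 4 * K ^ (1 / (p : ℝ)), fun d n L H F hd hF =>
      ⟨fun t ht => ?_, fun t ε ht hε => ?_⟩⟩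
    · have hh := strength_nonneg H
      calc _ ≤ K * ((d : ℝ) + 1) ^ p * H.strength * t ^ (p + 1) :=
            norm_eval_sub_evolution_le hd hp hF ht
        _ = K * (((d : ℝ) + 1) ^ p * H.strength) * t ^ (p + 1) := by ring
        _ ≤ K * (2 ^ p * (d : ℝ) ^ (p * (p + 1) / 2) * H.strength) * t ^ (p + 1) := by
          exact mul_le_mul_of_nonneg_right (mul_le_mul_of_nonneg_left
            (add_one_pow_mul_strength_le hd hp) hK) (pow_nonneg ht _)
        _ = K * 2 ^ p * (d : ℝ) ^ (p * (p + 1) / 2) * H.strength * t ^ (p + 1) := by ring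
        _ ≤ _ := by
          gcongr
          exact le_add_of_nonneg_right (by positivity)
    · obtain ⟨r, h1, h2⟩ := exists_trotterNumber_of_degreeLE hd hp hF ht hε
      refine ⟨r, h1, h2.trans (max_le_max le_rfl ?_)⟩
      have hh := strength_nonneg H
      set x := H.strength ^ (1 / (p : ℝ)) * t ^ (1 + 1 / (p : ℝ)) / ε ^ (1 / (p : ℝ)) with hx
      have hx0 : 0 ≤ x := by positivity
      have h3 : ((d : ℝ) + 1) * x ≤ 2 * d * x := add_one_mul_le hd hx0 fun h0 => by
        rw [hx, h0, Real.zero_rpow (by positivity), zero_mul, zero_div]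
      calc _ = 2 * K ^ (1 / (p : ℝ)) * (((d : ℝ) + 1) * x) := by ring
        _ ≤ 2 * K ^ (1 / (p : ℝ)) * (2 * d * x) := by gcongr
        _ = 4 * K ^ (1 / (p : ℝ)) * d * x := by ring
        _ ≤ _ := by
          gcongr
          · exact le_add_of_nonneg_left (by positivity)
          · exact natCast_le_rpow hp
  · obtain ⟨Υ, hΥ⟩ := exists_productFormula ((le_max_left _ _).trans hp)
    exact ⟨Υ, fun L => (hΥ (L + 1)).imp fun F hF n H => hF _ _⟩
  · have hp1 : 1 ≤ p := (le_max_left _ _).trans hp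
    have hp0 : (0 : ℝ) < p := by positivity
    have hδp : 1 / (p : ℝ) ≤ δ := by
      have h1 : 1 / δ ≤ p := (Nat.le_ceil _).trans (by exact_mod_cast (le_max_right _ _).trans hp)
      exact (one_div_le hδ hp0).1 h1
    have hK := errorConst_nonneg p Υ m
    refine ⟨2 * errorConst p Υ m ^ (1 / (p : ℝ)) * ((d : ℝ) + 1) *
      (2 * Υ : ℝ) ^ (δ - 1 / (p : ℝ)), fun n L H F hd hF t ε ht hε => ?_⟩
    -- Raising the exponent from `1/p` to `δ` is harmless only if `h_B t / ε` is bounded below;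
    -- otherwise a single step is accurate enough.
    rcases le_or_gt (2 * Υ * H.strength * t) ε with hle | hlt
    · exact ⟨1, trotterNumberSuffices_one hp1 hF ht hle, by simp⟩
    · obtain ⟨r, h1, h2⟩ := exists_trotterNumber_of_degreeLE hd hp1 hF ht hε
      refine ⟨r, h1, h2.trans (max_le_max le_rfl ?_)⟩
      rw [mul_assoc _ ((2 * Υ : ℝ) ^ (δ - 1 / (p : ℝ)))]
      gcongr
      exact rpow_le_of_lt (strength_nonneg H) ht hε (by positivity) hδp hlt
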